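/- **Setting.** Let $\mathcal G_b$ be a bipartite graph with $n$ agents, $n$ tasks and edge set $\mathcal E_b$, with real edge weights $w$, whose maximum cardinality matchings (MCMs) have $n$ edges; let $\mathcal M_0$ be an MCM. Each agent initially knows $n$, $D$, its label, its incident edges, their weights, and its partner in $\mathcal M_0$. The agents communicate synchronously, according to a global clock, over a connected undirected graph $\mathcal G_C$ on the agents with diameter $D$: in each time step every agent exchanges one message (at most one weighted edge with a tie-breaking number) with each of its neighbours and then computes locally. Complexity is the number of time steps of the global clock. For a set of edges $\mathcal E$ and a non-empty matching $\mathcal M$, let $\mathcal L(\mathcal M)$ be the set of heaviest edges of $\mathcal M$, $\psi(\mathcal E,\mathcal M)=\{e\in\mathcal E: w(e)\le\max_{\mathcal M}w\}$ and $\psi_S(\mathcal E,\mathcal M)=\{e\in\mathcal E: w(e)<\max_{\mathcal M}w\}$. For a matching $\mathcal M'$ and an edge set $\mathcal S$, AugPath$(\mathcal M',\mathcal S)$ returns an MCM of the current graph contained in $\mathcal S$ if $\mathcal S$ contains an augmenting path relative to $\mathcal M'$, and returns $\mathcal M'$ otherwise. **Algorithm 1.** Start with $\bar{\mathcal V}$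 the set of all agents and tasks, $\bar{\mathcal E}=\mathcal E_b$, $\bar{\mathcal M}=\mathcal M_0$, $\mathcal M_b=\emptyset$, $\mathcal U=\mathrm{True}$. While $\bar{\mathcal M}\ne\emptyset$: 1. Let $\bar{\mathcal G}=(\bar{\mathcal V},\bar{\mathcal E})$, choose any $\bar e\in\mathcal L(\bar{\mathcal M})$, replace $\bar{\mathcal E}$ by $\bar{\mathcal M}\cup\psi_S(\bar{\mathcal E},\bar{\mathcal M})$, and let $\mathcal M_\nu=$ AugPath$(\bar{\mathcal M}\setminus\{\bar e\},\bar{\mathcal E}\setminus\{\bar e\})$. 2. If $\mathcal M_\nu\ne\bar{\mathcal M}\setminus\{\bar e\}$, set $\bar{\mathcal M}\leftarrow\mathcal M_\nu$. 3. Otherwise let $E'$ be the set of all $e'\in\bar{\mathcal M}$ such that AugPath$(\bar{\mathcal M}\setminus\{e'\},\psi(\bar{\mathcal G},\bar{\mathcal M})\setminus\{e'\})$ returns $\bar{\mathcal M}\setminus\{e'\}$ (here $\psi(\bar{\mathcal G},\cdot)$ refers to the edge set before it was replaced in step 1). If $E'\cap\mathcal L(\bar{\mathcal M})=\emptyset$,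 set $\mathcal U\leftarrow\mathrm{False}$ and add $\bar e$ to $E'$. Then delete from the current graph all vertices incident to $E'$, and set $\bar{\mathcal M}\leftarrow\bar{\mathcal M}\setminus E'$ and $\mathcal M_b\leftarrow\mathcal M_b\cup E'$. Return $\mathcal M_b,\mathcal U$. **Distributed implementation.** All steps are carried out by max-consensus procedures of $\max(D,1)$ time steps each, in which every agent nominates at most one edge and all agents learn the heaviest nominated edge (ties being broken by arbitrary, time-dependent priorities, then by labels). AugPath$(\mathcal M\setminus\{(i_0,j_0)\},\mathcal S)$ is a search from the free task $j_0$: every agent not reached before that has an edge of $\mathcal S$ to the current task is marked as reached from it; a consensus selects a reached agent from which the search has not yet been continued; the search fails if there is none, succeeds if the selected agent is $i_0$, and otherwise continues at that agent's matched task. After a successful search in step 1 the edges along the path found are exchanged one at a time, by one consensus each; in step 3 only success or failure is used. **Proposition.** There is a constant $C$ such that for all $n\ge1$, all $\mathcal G_b$, $w$, $\mathcal M_0$ and $\mathcal G_C$ as above, and all tie-breaking priorities, this implementation of Algorithm 1 halts after at most $C\,n^3\max(D,1)$ time steps, and the pair $(\mathcal M_b,\mathcal U)$ it returns is the output of an execution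 of Algorithm 1. Thus the worst-case complexity of Algorithm 1 is $O(n^3D)$. (Here $D\ge1$ unless $n=1$.) In particular, in the centralised case, where every agent communicates directly with every other agent, the implementation halts after at most $C\,n^3$ time steps. -/

import Mathlib

namespace SeqBAP

/-! ## Bipartite graphs, matchings, augmenting paths

Agents and tasks are both labelled by `Fin n`. An edge joining agent `i` and task `j` is the
pair `(i, j)`; a bipartite graph is given by its finite set of edges. -/

abbrev Edge (n : ℕ) := Fin n × Fin n

/-- `Sum.inl i` is agent `i`, `Sum.inr j` is task `j`. -/
abbrev Vertex (n : ℕ) := Fin n ⊕ Fin n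

variable {n : ℕ} {W : Type} [LinearOrder W]

def Incident (v : Vertex n) (e : Edge n) : Prop :=
  v = Sum.inl e.1 ∨ v = Sum.inr e.2

def Joins (e : Edge n) (u v : Vertex n) : Prop :=
  (u = Sum.inl e.1 ∧ v = Sum.inr e.2) ∨ (u = Sum.inr e.2 ∧ v = Sum.inl e.1)

/-- A matching of the graph with edge set `E`. -/
def IsMatching (E M : Finset (Edge n)) : Prop :=
  M ⊆ E ∧ ∀ v : Vertex n, ∀ e ∈ M, ∀ e' ∈ M, Incident v e → Incident v e' → e = e'

/-- A maximum cardinality matching of the graph with edge set `E`. -/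
def IsMCM (E M : Finset (Edge n)) : Prop :=
  IsMatching E M ∧ ∀ M', IsMatching E M' → M'.card ≤ M.card

/-- `P` is the edge set of a path of positive length between `a` and `b` in the graph with edge
set `E`. -/
def IsPath (E P : Finset (Edge n)) (a b : Vertex n) : Prop :=
  P ⊆ E ∧ ∃ (l : ℕ) (v : ℕ → Vertex n), 1 ≤ l ∧ v 0 = a ∧ v l = b ∧
    (∀ k ≤ l, ∀ k' ≤ l, v k = v k' → k = k') ∧
    (∀ k < l, ∃ e ∈ P, Joins e (v k) (v (k + 1))) ∧
    (∀ e ∈ P, ∃ k < l, Joins e (v k) (v (k + 1)))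

/-- Every vertex is incident to at most one edge of `P ∩ M` and at most one edge of `P \ M`. -/
def IsAlternating (M P : Finset (Edge n)) : Prop :=
  ∀ v : Vertex n,
    (∀ e ∈ P ∩ M, ∀ e' ∈ P ∩ M, Incident v e → Incident v e' → e = e') ∧
    (∀ e ∈ P \ M, ∀ e' ∈ P \ M, Incident v e → Incident v e' → e = e')

def IsFree (M : Finset (Edge n)) (v : Vertex n) : Prop :=
  ∀ e ∈ M, ¬ Incident v e

/-- `P` is an augmenting path relative to `M`, contained in the edge set `E`. -/
def IsAugmenting (E M P : Finset (Edge n)) : Prop :=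
  ∃ a b, IsPath E P a b ∧ IsAlternating M P ∧ IsFree M a ∧ IsFree M b

/-! ## The algorithm (centralised pseudocode) -/

/-- The edges of `M` with largest weight. -/
def heaviest (w : Edge n → W) (M : Finset (Edge n)) : Finset (Edge n) :=
  M.filter fun e => ∀ e' ∈ M, w e' ≤ w e

/-- The matching-sublevel set: the edges of `E` with weight at most the largest weight in `M`. -/
def sublevel (w : Edge n → W) (E M : Finset (Edge n)) : Finset (Edge n) :=
  E.filter fun e => ∃ e' ∈ M, w e ≤ w e'

/-- The strict matching-sublevel set. -/
def strictSublevel (w : Edge n → W) (E M : Finset (Edge n)) : Finset (Edge n) :=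
  E.filter fun e => ∃ e' ∈ M, w e < w e'

/-- `R` is an admissible value of `AugPath(M', S)` in the graph with edge set `G`: a maximum
cardinality matching of `G` contained in `S` if `S` contains an augmenting path relative to `M'`,
and `M'` itself otherwise. -/
def AugPathReturns (G M' S R : Finset (Edge n)) : Prop :=
  ((∃ P, IsAugmenting S M' P) → IsMCM G R ∧ R ⊆ S) ∧
  ((¬ ∃ P, IsAugmenting S M' P) → R = M')

/-- The variables of the algorithm: the current graph `(vs, es)`, the current matching `cur`,
the edges `sol` selected so far and the uniqueness flag. -/
structure AlgState (n : ℕ) where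
  vs : Finset (Vertex n)
  es : Finset (Edge n)
  cur : Finset (Edge n)
  sol : Finset (Edge n)
  flag : Bool

/-- Initialisation with the graph `E` and the matching `M₀`. -/
def AlgState.init (E M₀ : Finset (Edge n)) : AlgState n :=
  { vs := Finset.univ, es := E, cur := M₀, sol := ∅, flag := true }

/-- The set of edges over which the first search of an iteration takes place, before the removal
of the tested edge. -/
def AlgState.shrunk (w : Edge n → W) (s : AlgState n) : Finset (Edge n) :=
  s.cur ∪ strictSublevel w s.es s.cur

/-- Remove the edges `E'` of the current matching, and all vertices incident to them, from the
current graph, and add them to the solution. -/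
def AlgState.remove (s : AlgState n) (E' : Finset (Edge n)) : AlgState n :=
  let vs' := s.vs \ (E'.image (fun e => Sum.inl e.1) ∪ E'.image (fun e => Sum.inr e.2))
  { vs := vs'
    es := s.es.filter fun e => Sum.inl e.1 ∈ vs' ∧ Sum.inr e.2 ∈ vs'
    cur := s.cur \ E'
    sol := s.sol ∪ E'
    flag := s.flag }

/-- One iteration of the while-loop. The choice of the heaviest edge `b` and the values returned
by `AugPath` are arbitrary. In the second case `b` is a critical bottleneck edge, `R e` is the
value returned in the test of the edge `e`, and `pos` is the set of edges whose test found no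
augmenting path, i.e. the edges found to have positive price of absence. -/
inductive Iter (w : Edge n → W) : AlgState n → AlgState n → Prop
  | noncritical (s : AlgState n) (b : Edge n) (R : Finset (Edge n))
      (hb : b ∈ heaviest w s.cur)
      (hR : AugPathReturns s.es (s.cur \ {b}) (s.shrunk w \ {b}) R)
      (hne : R ≠ s.cur \ {b}) :
      Iter w s { s with es := s.shrunk w, cur := R }
  | critical (s : AlgState n) (b : Edge n) (R : Edge n → Finset (Edge n))
      (pos : Finset (Edge n))
      (hb : b ∈ heaviest w s.cur)
      (hcrit : AugPathReturns s.es (s.cur \ {b}) (s.shrunk w \ {b}) (s.cur \ {b}))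
      (hR : ∀ e ∈ s.cur, AugPathReturns s.es (s.cur \ {e}) (sublevel w s.es s.cur \ {e}) (R e))
      (hpos : pos = s.cur.filter fun e => R e = s.cur \ {e}) :
      Iter w s
        (if pos ∩ heaviest w s.cur = ∅ then
          ({ s with es := s.shrunk w, flag := false } : AlgState n).remove (pos ∪ {b})
        else
          ({ s with es := s.shrunk w } : AlgState n).remove pos)

/-- `(Mb, U)` is an output of an execution of the algorithm on the graph `E` with weights `w`,
initialised with the matching `M₀`. -/
def AlgOutput (w : Edge n → W) (E M₀ Mb : Finset (Edge n)) (U : Bool) : Prop :=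
  ∃ s, Relation.ReflTransGen (Iter w) (AlgState.init E M₀) s ∧
    s.cur = ∅ ∧ s.sol = Mb ∧ s.flag = U

/-! ## The distributed implementation

Every agent runs the same program. The program is a sequence of max-consensus procedures: in each
of them every agent nominates at most one of its own incident edges, and after `D` time steps all
agents know the heaviest nominated edge, whereupon each agent updates its own variables. -/

/-- The point of the program that is being executed, with the variables that are common to all
agents. Here `b` is the edge currently tested for being a critical bottleneck edge and `wb` is its
weight. -/
inductive Phase (W : Type) (n : ℕ)
  /-- find a heaviest edge of the current matching -/
  | pick
  /-- `AugPath`, search: is there an augmenting path after removal of `b`? -/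
  | searchCrit (b : Edge n) (wb : W)
  /-- `AugPath`, augmentation: exchange the edges along the path that has been found -/
  | augment (b : Edge n)
  /-- for-loop over the edges of the current matching: find the next one -/
  | nextEdge (b : Edge n) (wb : W)
  /-- `AugPath`, search: is the price of absence of `e` positive? -/
  | searchPos (b : Edge n) (wb : W) (e : Edge n)
  /-- is there a heaviest edge with positive price of absence? -/
  | checkTop (b : Edge n) (wb : W)
  /-- remove the selected edges and their end points from the graph, one at a time -/
  | prune
  | halted

/-- The memory of one agent. -/
structure Agent (W : Type) (n : ℕ) where
  /-- own label -/
  id : Fin n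
  /-- weights of the own incident edges -/
  wt : Fin n → W
  /-- own incident edges in the current edge set -/
  edge : Fin n → Bool
  /-- own incident edges in the edge set at the beginning of the iteration -/
  edgeOld : Fin n → Bool
  /-- own partner in the current matching (`none` once the agent is removed) -/
  mate : Option (Fin n)
  /-- own partner in the solution -/
  sel : Option (Fin n)
  /-- uniqueness flag -/
  flag : Bool
  phase : Phase W n
  /-- search: the task from which this agent was reached -/
  parent : Option (Fin n)
  /-- search: the search has already been continued from this agent -/
  expanded : Bool
  /-- augmentation: it is the turn of this agent to change its partner -/
  active : Bool
  /-- for-loop: the edge between this agent and its mate has been tested -/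
  tested : Bool
  /-- the edge between this agent and its mate is in the set of edges to be selected -/
  pos : Bool

/-- Initial memory, from the label `i`, the own incident edges, their weights and the own partner
in the initial matching. -/
def Agent.init (i : Fin n) (edge : Fin n → Bool) (wt : Fin n → W) (mate : Option (Fin n)) :
    Agent W n :=
  { id := i, wt := wt, edge := edge, edgeOld := edge, mate := mate, sel := none, flag := true
    phase := .pick, parent := none, expanded := false, active := false
    tested := false, pos := false }

/-- The task `j` such that the agent nominates its edge to `j`, if any. -/
def Agent.nominee (a : Agent W n) : Option (Fin n) :=
  match a.phase with
  | .pick => a.mate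
  | .searchCrit _ _ => if a.parent.isSome && !a.expanded then a.mate else none
  | .augment _ => if a.active then a.parent else none
  | .nextEdge _ _ => if !a.tested then a.mate else none
  | .searchPos _ _ _ => if a.parent.isSome && !a.expanded then a.mate else none
  | .checkTop _ wb =>
      match a.mate with
      | some j => if a.pos && decide (a.wt j = wb) then some j else none
      | none => none
  | .prune => if a.pos then a.mate else none
  | .halted => none

/-- The edges of the agent that the current search may use. -/
def Agent.usable (a : Agent W n) (j : Fin n) : Bool :=
  match a.phase with
  | .searchCrit b _ => a.edge j && decide ((a.id, j) ≠ b)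
  | .searchPos _ wb e => a.edgeOld j && decide (a.wt j ≤ wb) && decide ((a.id, j) ≠ e)
  | _ => false

/-- The search arrives at task `j`: the agent is reached from `j` if it has a usable edge to `j`
and has not been reached before. -/
def Agent.reach (a : Agent W n) (j : Fin n) : Agent W n :=
  if a.parent.isNone && a.usable j then { a with parent := some j } else a

/-- Start a search in phase `p` at the task `j`. -/
def Agent.startSearch (a : Agent W n) (p : Phase W n) (j : Fin n) : Agent W n :=
  ({ a with phase := p, parent := none, expanded := false } : Agent W n).reach j

/-- Continue a search from agent `e.1`, along the matched edge `e`, at the task `e.2`. -/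
def Agent.expand (a : Agent W n) (e : Edge n) : Agent W n :=
  ({ a with expanded := a.expanded || decide (a.id = e.1) } : Agent W n).reach e.2

/-- The local computation at the end of a max-consensus, given its result: `none` if no edge was
nominated, and otherwise the heaviest nominated edge with its weight. -/
def Agent.update (a : Agent W n) (r : Option (W × Edge n)) : Agent W n :=
  match a.phase, r with
  | .pick, none => { a with phase := .halted }
  | .pick, some (wb, b) =>
      ({ a with
          edgeOld := a.edge
          edge := fun j => decide (a.mate = some j) || (a.edge j && decide (a.wt j < wb))
          tested := false
          pos := false } : Agent W n).startSearch (.searchCrit b wb) b.2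
  | .searchCrit b wb, none => { a with phase := .nextEdge b wb }
  | .searchCrit b _, some (_, e) =>
      if e.1 = b.1 then { a with phase := .augment b, active := decide (a.id = b.1) }
      else a.expand e
  | .augment _, none => a
  | .augment b, some (_, e) =>
      { a with
        mate := if a.id = e.1 then some e.2 else a.mate
        active := decide (e.2 ≠ b.2) && decide (a.id ≠ e.1) && decide (a.mate = some e.2)
        phase := if e.2 = b.2 then .pick else .augment b }
  | .nextEdge b wb, none => { a with phase := .checkTop b wb }
  | .nextEdge b wb, some (_, e) =>
      ({ a with tested := a.tested || decide (a.id = e.1) } : Agent W n).startSearch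
        (.searchPos b wb e) e.2
  | .searchPos b wb e, none =>
      { a with pos := a.pos || decide (a.id = e.1), phase := .nextEdge b wb }
  | .searchPos b wb e, some (_, e') =>
      if e'.1 = e.1 then { a with phase := .nextEdge b wb } else a.expand e'
  | .checkTop b _, none =>
      { a with flag := false, pos := a.pos || decide (a.id = b.1), phase := .prune }
  | .checkTop _ _, some _ => { a with phase := .prune }
  | .prune, none => { a with phase := .pick }
  | .prune, some (_, e) =>
      if a.id = e.1 then
        { a with edge := fun _ => false, mate := none, sel := some e.2, pos := false }
      else { a with edge := fun j => a.edge j && decide (j ≠ e.2) }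
  | .halted, _ => a

/-! ### The synchronous network -/

/-- A message: nothing, or a nominated edge, preceded by its weight and by a number that serves to
break ties. Messages are ordered lexicographically. -/
abbrev Msg (W : Type) (n : ℕ) := WithBot (W ×ₗ ℕ ×ₗ Fin n ×ₗ Fin n)

/-- The edge in a message, with its weight. -/
def Msg.content (m : Msg W n) : Option (W × Edge n) :=
  match m with
  | none => none
  | some x =>
      some ((ofLex x).1, ((ofLex (ofLex (ofLex x).2).2).1, (ofLex (ofLex (ofLex x).2).2).2))

/-- The message with which an agent enters a max-consensus, with tie-breaking number `q`. -/
def Agent.message (a : Agent W n) (q : ℕ) : Msg W n :=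
  match a.nominee with
  | none => none
  | some j => some (toLex (a.wt j, toLex (q, toLex (a.id, j))))

/-- An agent in the network: its memory, the largest message it knows of in the current
max-consensus, and the number of time steps since the beginning of that max-consensus. -/
structure Node (W : Type) (n : ℕ) where
  agent : Agent W n
  msg : Msg W n
  clock : ℕ

/-- What an agent does in one time step of the global clock, after having received the message
`m`, the largest of its neighbours' messages. -/
def Node.step (D q : ℕ) (x : Node W n) (m : Msg W n) : Node W n :=
  let m' := max x.msg m
  if x.clock + 1 < D then { x with msg := m', clock := x.clock + 1 }
  else
    let a := x.agent.update (Msg.content m')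
    { agent := a, msg := a.message q, clock := 0 }

/-- The network after `t` time steps of the global clock. In each step every agent exchanges its
message with its neighbours in the communication graph `GC`. The graph has edge set `E` and
weights `w`; agent `i` starts with its incident edges, their weights, and its partner in the
initial matching `M₀`. The ties between edges of equal weight are broken by `tie`. -/
def network (GC : SimpleGraph (Fin n)) [DecidableRel GC.Adj] (D : ℕ) (tie : ℕ → Fin n → ℕ)
    (w : Edge n → W) (E M₀ : Finset (Edge n)) : ℕ → Fin n → Node W n
  | 0 => fun i =>
      let a := Agent.init i (fun j => decide ((i, j) ∈ E)) (fun j => w (i, j))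
        ((List.finRange n).find? fun j => decide ((i, j) ∈ M₀))
      { agent := a, msg := a.message (tie 0 i), clock := 0 }
  | t + 1 => fun i =>
      let x := network GC D tie w E M₀ t
      (x i).step D (tie (t + 1) i) ((GC.neighborFinset i).sup fun k => (x k).msg)

/-- The agents have all halted, and the partners they have selected and the flags they hold are
`Mb` and `U`. -/
def HaltedWith (x : Fin n → Node W n) (Mb : Finset (Edge n)) (U : Bool) : Prop :=
  (∀ i, (x i).agent.phase = .halted) ∧
  (∀ i j, (i, j) ∈ Mb ↔ (x i).agent.sel = some j) ∧
  (∀ i, (x i).agent.flag = U)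

/-- On the given input the distributed implementation halts after at most `T` time steps, and what
it returns is an output of the algorithm. -/
def RunsWithin (GC : SimpleGraph (Fin n)) [DecidableRel GC.Adj] (tie : ℕ → Fin n → ℕ)
    (w : Edge n → W) (E M₀ : Finset (Edge n)) (T : ℕ) : Prop :=
  ∃ t ≤ T, ∃ Mb U, HaltedWith (network GC GC.diam tie w E M₀ t) Mb U ∧ AlgOutput w E M₀ Mb U

end SeqBAP

namespace SeqBAP

variable {n : ℕ} {W : Type} [LinearOrder W]

/-! ## Rounds of max-consensus -/

/-! The network is first separated from the algorithm. Flooding for `max D 1` steps on a connected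
graph of diameter `D` leaves all agents with the same maximal message, so the network follows a
sequence of abstract rounds in which some heaviest nominated edge wins (`round_of_consensus`). Since
`Round` allows every such winner, a bound over all sequences of rounds (`Within`) covers all
tie-breaking rules. The bounds are proved in continuation style: if what follows takes `N` rounds,
the present stage together with it takes `N` plus its own cost.

Correctness rests on an invariant: the current matching covers the whole current graph
(`AlgState.IsValid`, `IsSpanning`). It holds initially because the matching has `n` edges, and
persists because vertices are deleted in matched pairs. After removal of a matched edge `e₀`, the
only free vertices that lie on any edge are the ends of `e₀`. An augmenting path must join them, and
one search from `e₀.2` decides whether it exists. A failed search has closed its reached set, which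
no alternating path can leave (`SearchInv.not_isPath`). A successful one yields a path in the search
tree (`SearchInv.exists_isAugmenting`), along which the exchange restores a covering matching, hence
one of maximum cardinality (`AugInv.step`, `AugInv.finish`).

For the count, a search or an augmentation takes `O(n)` rounds, so a noncritical iteration costs
`O(n)` and a critical one, with up to `n` tests, `O(n²)`. A noncritical iteration removes the tested
edge from the searched edge set for good, which can happen at most `n²` times. A critical iteration
shrinks the matching, which can happen at most `n` times. `AlgState.potential` weights the two
resources accordingly and starts at no more than `20 * n ^ 3`; `within_iteration` pays for each
iteration out of its decrease. -/

/-- The memories of all agents. -/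
abbrev Config (W : Type) (n : ℕ) := Fin n → Agent W n

/-- `r` is a possible result of a max-consensus: nothing if no edge is nominated, and otherwise a
heaviest nominated edge. -/
def Winner (x : Config W n) (r : Option (W × Edge n)) : Prop :=
  (r = none ∧ ∀ i, (x i).nominee = none) ∨
  ∃ i j, (x i).nominee = some j ∧ r = some ((x i).wt j, ((x i).id, j)) ∧
    ∀ i' j', (x i').nominee = some j' → (x i').wt j' ≤ (x i).wt j

/-- One max-consensus, followed by the local computations. -/
def Round (x y : Config W n) : Prop :=
  ∃ r, Winner x r ∧ ∀ i, y i = (x i).update r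

/-- Every sequence of rounds that starts from the given configuration meets `Q` after at most the
given number of rounds. -/
inductive Within (Q : Config W n → Prop) : ℕ → Config W n → Prop
  | done (N : ℕ) (x : Config W n) : Q x → Within Q N x
  | step (N : ℕ) (x : Config W n) : (∀ y, Round x y → Within Q N y) → Within Q (N + 1) x

theorem Within.mono {Q : Config W n → Prop} {N : ℕ} {x : Config W n} (h : Within Q N x) :
    ∀ {N' : ℕ}, N ≤ N' → Within Q N' x := by
  induction h with
  | done N x hx => exact fun _ => .done _ _ hx
  | step N x _ ih =>
    intro N' hN
    obtain ⟨k, rfl⟩ : ∃ k, N' = k + 1 := ⟨N' - 1, by omega⟩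
    exact .step _ _ fun y hy => ih y hy (by omega)

/-- This is how the inductive bound is used: it is applied to the single sequence of rounds that the
network produces. -/
theorem Within.exists_le {Q : Config W n → Prop} {N : ℕ} {x : Config W n} (h : Within Q N x) :
    ∀ A : ℕ → Config W n, A 0 = x → (∀ k, Round (A k) (A (k + 1))) → ∃ k ≤ N, Q (A k) := by
  induction h with
  | done N x hx => exact fun A h0 _ => ⟨0, Nat.zero_le _, h0 ▸ hx⟩
  | step N x _ ih =>
    intro A h0 hA
    obtain ⟨k, hk, hQ⟩ := ih (A 1) (h0 ▸ hA 0) (fun k => A (k + 1)) rfl fun k => hA (k + 1)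
    exact ⟨k + 1, by omega, hQ⟩

theorem winner_of_max_message (x : Config W n) (q : Fin n → ℕ) (m : Msg W n)
    (hle : ∀ k, (x k).message (q k) ≤ m) (hm : ∃ k, m = (x k).message (q k)) :
    Winner x (Msg.content m) := by
  obtain ⟨i, rfl⟩ := hm
  have key : ∀ k j, (x k).nominee = some j → (x k).message (q k) =
      ((toLex ((x k).wt j, toLex (q k, toLex ((x k).id, j))) : W ×ₗ ℕ ×ₗ Fin n ×ₗ Fin n) :
        Msg W n) := by
    intro k j h
    simp only [Agent.message, h]
    rfl
  cases h : (x i).nominee with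
  | none =>
    have hbot : (x i).message (q i) = (⊥ : Msg W n) := by
      simp only [Agent.message, h]
      rfl
    left
    refine ⟨by rw [hbot]; rfl, fun k => ?_⟩
    cases hk : (x k).nominee with
    | none => rfl
    | some j =>
      have := hle k
      rw [hbot, key k j hk] at this
      exact absurd (le_bot_iff.1 this) (WithBot.coe_ne_bot)
  | some j =>
    right
    refine ⟨i, j, h, by rw [key i j h]; rfl, fun i' j' h' => ?_⟩
    have := hle i'
    -- The weight is the leading lexicographic component, so the tie-breaking numbers never affect
    -- which weight wins.
    rw [key i j h, key i' j' h', WithBot.coe_le_coe, Prod.Lex.toLex_le_toLex] at this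
    rcases this with h | h
    · exact h.le
    · exact h.1.le

/-! ### Simulation of rounds by the synchronous network. -/

section Network

variable (GC : SimpleGraph (Fin n)) [DecidableRel GC.Adj] (D : ℕ) (tie : ℕ → Fin n → ℕ)
  (w : Edge n → W) (E M₀ : Finset (Edge n))

/-- A max-consensus begins at time `t`. -/
def IsFresh (t : ℕ) : Prop :=
  ∀ i, (network GC D tie w E M₀ t i).clock = 0 ∧
    (network GC D tie w E M₀ t i).msg = (network GC D tie w E M₀ t i).agent.message (tie t i)

/-- Induction step of flooding: a walk of length `c + 1` is one edge to a neighbour followed by a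
walk of length at most `c`, whose information that neighbour already holds. Taking maxima never
creates a message that was not there at the start. -/
theorem max_message_step (t : ℕ) (m₀ : Fin n → Msg W n) (c : ℕ)
    (hex : ∀ i, ∃ k, (network GC D tie w E M₀ t i).msg = m₀ k)
    (hle : ∀ i k (p : GC.Walk i k), p.length ≤ c → m₀ k ≤ (network GC D tie w E M₀ t i).msg)
    (i : Fin n) :
    (∃ k, max (network GC D tie w E M₀ t i).msg
      ((GC.neighborFinset i).sup fun k => (network GC D tie w E M₀ t k).msg) = m₀ k) ∧
    ∀ k (p : GC.Walk i k), p.length ≤ c + 1 →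
      m₀ k ≤ max (network GC D tie w E M₀ t i).msg
        ((GC.neighborFinset i).sup fun k => (network GC D tie w E M₀ t k).msg) := by
  constructor
  · rcases max_choice (network GC D tie w E M₀ t i).msg
      ((GC.neighborFinset i).sup fun k => (network GC D tie w E M₀ t k).msg) with h | h
    · rw [h]; exact hex i
    · rcases (GC.neighborFinset i).eq_empty_or_nonempty with h' | h'
      -- An isolated agent receives the bottom message, which leaves its own unchanged.
      · have h0 : ((GC.neighborFinset i).sup fun k => (network GC D tie w E M₀ t k).msg) = ⊥ := by
          rw [h', Finset.sup_empty]
        rw [h0, max_bot_right]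
        exact hex i
      · obtain ⟨k, _, hk⟩ := Finset.exists_mem_eq_sup _ h'
          (fun k => (network GC D tie w E M₀ t k).msg)
        rw [h, hk]
        exact hex k
  · intro k p hp
    cases p with
    | nil => exact le_max_of_le_left (hle i i .nil (by simp))
    | @cons _ i' _ hadj p =>
      refine le_max_of_le_right ((hle i' k p ?_).trans ?_)
      · simp only [SimpleGraph.Walk.length_cons] at hp
        omega
      · exact Finset.le_sup (f := fun k => (network GC D tie w E M₀ t k).msg)
          ((GC.mem_neighborFinset i i').2 hadj)

theorem network_during_consensus {t : ℕ} (h : IsFresh GC D tie w E M₀ t) (c : ℕ)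
    (hc : c < max D 1) :
    (∀ i, (network GC D tie w E M₀ (t + c) i).clock = c ∧
      (network GC D tie w E M₀ (t + c) i).agent = (network GC D tie w E M₀ t i).agent) ∧
    (∀ i, ∃ k, (network GC D tie w E M₀ (t + c) i).msg =
      (network GC D tie w E M₀ t k).agent.message (tie t k)) ∧
    (∀ i k (p : GC.Walk i k), p.length ≤ c →
      (network GC D tie w E M₀ t k).agent.message (tie t k) ≤
        (network GC D tie w E M₀ (t + c) i).msg) := by
  induction c with
  | zero =>
    refine ⟨fun i => ⟨(h i).1, rfl⟩, fun i => ⟨i, (h i).2⟩, fun i k p hp => ?_⟩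
    obtain rfl := SimpleGraph.Walk.eq_of_length_eq_zero (Nat.le_zero.1 hp)
    exact (h i).2.ge
  | succ c ih =>
    obtain ⟨h1, h2, h3⟩ := ih (by omega)
    have hD : c + 1 < D := by omega
    have hstep : ∀ i, network GC D tie w E M₀ (t + (c + 1)) i =
        { agent := (network GC D tie w E M₀ t i).agent
          msg := max (network GC D tie w E M₀ (t + c) i).msg
            ((GC.neighborFinset i).sup fun k => (network GC D tie w E M₀ (t + c) k).msg)
          clock := c + 1 } := by
      intro i
      rw [← add_assoc]
      simp only [network, Node.step, (h1 i).1, if_pos hD, (h1 i).2]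
    have hmax := max_message_step GC D tie w E M₀ (t + c)
      (fun k => (network GC D tie w E M₀ t k).agent.message (tie t k)) c h2 h3
    refine ⟨fun i => ?_, fun i => ?_, fun i k p hp => ?_⟩
    · rw [hstep]; exact ⟨rfl, rfl⟩
    · rw [hstep]; exact (hmax i).1
    · rw [hstep]; exact (hmax i).2 k p hp

/-- Every maximum held at the end is attained by an initial message and dominates all of them, so
all agents hold the same one and make the same local transition. -/
theorem round_of_consensus (hconn : GC.Connected) (hD : D = GC.diam) {t : ℕ}
    (h : IsFresh GC D tie w E M₀ t) :
    IsFresh GC D tie w E M₀ (t + max D 1) ∧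
    Round (fun i => (network GC D tie w E M₀ t i).agent)
      (fun i => (network GC D tie w E M₀ (t + max D 1) i).agent) := by
  have := hconn.nonempty
  have hfin : GC.ediam ≠ ⊤ := SimpleGraph.connected_iff_ediam_ne_top.1 hconn
  obtain ⟨c, hc⟩ : ∃ c, max D 1 = c + 1 := ⟨max D 1 - 1, by omega⟩
  obtain ⟨h1, h2, h3⟩ := network_during_consensus GC D tie w E M₀ h c (by omega)
  -- The last step of a consensus performs both the final exchange and the update. There is such a
  -- step even when `D = 0`, hence `max D 1`.
  have hnot : ¬ c + 1 < D := by omega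
  set m₀ : Fin n → Msg W n := fun k => (network GC D tie w E M₀ t k).agent.message (tie t k)
  set m : Fin n → Msg W n := fun i => max (network GC D tie w E M₀ (t + c) i).msg
    ((GC.neighborFinset i).sup fun k => (network GC D tie w E M₀ (t + c) k).msg) with hm
  have hmax := max_message_step GC D tie w E M₀ (t + c) m₀ c h2 h3
  have hex : ∀ i, ∃ k, m i = m₀ k := fun i => (hmax i).1
  have hle : ∀ i k, m₀ k ≤ m i := by
    intro i k
    obtain ⟨p, hp⟩ := hconn.exists_walk_length_eq_dist i k
    refine (hmax i).2 k p ?_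
    have := SimpleGraph.dist_le_diam hfin (u := i) (v := k)
    omega
  have hstep : ∀ i, network GC D tie w E M₀ (t + max D 1) i =
      { agent := (network GC D tie w E M₀ t i).agent.update (Msg.content (m i))
        msg := ((network GC D tie w E M₀ t i).agent.update (Msg.content (m i))).message
          (tie (t + max D 1) i)
        clock := 0 } := by
    intro i
    rw [hc, ← add_assoc]
    simp only [network, Node.step, (h1 i).1, if_neg hnot, (h1 i).2, hm]
  refine ⟨fun i => by rw [hstep]; exact ⟨rfl, rfl⟩, ?_⟩
  obtain ⟨i₀⟩ := this
  refine ⟨Msg.content (m i₀), ?_, fun i => ?_⟩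
  · exact winner_of_max_message _ (tie t) (m i₀) (hle i₀) (hex i₀)
  · have : m i = m i₀ := by
      obtain ⟨k, hk⟩ := hex i
      obtain ⟨k', hk'⟩ := hex i₀
      exact le_antisymm (hk ▸ hle i₀ k) (hk' ▸ hle i k')
    simp only [hstep, this]

/-- The configuration at the beginning. -/
def initConfig : Config W n := fun i =>
  Agent.init i (fun j => decide ((i, j) ∈ E)) (fun j => w (i, j))
    ((List.finRange n).find? fun j => decide ((i, j) ∈ M₀))

theorem exists_network_of_within (hconn : GC.Connected) {Q : Config W n → Prop} {N : ℕ}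
    (h : Within Q N (initConfig w E M₀)) :
    ∃ t ≤ N * max GC.diam 1, Q fun i => (network GC GC.diam tie w E M₀ t i).agent := by
  have hfresh : ∀ k, IsFresh GC GC.diam tie w E M₀ (k * max GC.diam 1) := by
    intro k
    induction k with
    | zero => rw [zero_mul]; exact fun i => ⟨rfl, rfl⟩
    | succ k ih =>
      rw [Nat.succ_mul]
      exact (round_of_consensus GC GC.diam tie w E M₀ hconn rfl ih).1
  obtain ⟨k, hk, hQ⟩ := h.exists_le
    (fun k i => (network GC GC.diam tie w E M₀ (k * max GC.diam 1) i).agent)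
    (by simp only [zero_mul]; rfl)
    (fun k => by
      rw [Nat.succ_mul]
      exact (round_of_consensus GC GC.diam tie w E M₀ hconn rfl (hfresh k)).2)
  exact ⟨k * max GC.diam 1, Nat.mul_le_mul_right _ hk, hQ⟩

end Network

/-! ## Matchings that cover a graph -/

/-- `M` is a matching of the graph `G` that covers all end points of edges of `G`. -/
structure IsSpanning (G M : Finset (Edge n)) : Prop where
  sub : M ⊆ G
  left : ∀ {i j j'}, (i, j) ∈ M → (i, j') ∈ M → j = j'
  right : ∀ {i i' j}, (i, j) ∈ M → (i', j) ∈ M → i = i'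
  agent : ∀ {i j}, (i, j) ∈ G → ∃ j', (i, j') ∈ M
  task : ∀ {i j}, (i, j) ∈ G → ∃ i', (i', j) ∈ M

theorem incident_inl {i : Fin n} {e : Edge n} : Incident (Sum.inl i) e ↔ e.1 = i := by
  simp [Incident, eq_comm]

theorem incident_inr {j : Fin n} {e : Edge n} : Incident (Sum.inr j) e ↔ e.2 = j := by
  simp [Incident, eq_comm]

theorem isMatching_iff {G M : Finset (Edge n)} :
    IsMatching G M ↔ M ⊆ G ∧ (∀ i j j', (i, j) ∈ M → (i, j') ∈ M → j = j') ∧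
      (∀ i i' j, (i, j) ∈ M → (i', j) ∈ M → i = i') := by
  constructor
  · rintro ⟨h1, h2⟩
    refine ⟨h1, fun i j j' h h' => ?_, fun i i' j h h' => ?_⟩
    · exact congrArg Prod.snd
        (h2 (Sum.inl i) _ h _ h' (incident_inl.2 rfl) (incident_inl.2 rfl))
    · exact congrArg Prod.fst
        (h2 (Sum.inr j) _ h _ h' (incident_inr.2 rfl) (incident_inr.2 rfl))
  · rintro ⟨h1, h2, h3⟩
    refine ⟨h1, ?_⟩
    rintro (v | v) ⟨i, j⟩ he ⟨i', j'⟩ he' hi hi'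
    · rw [incident_inl] at hi hi'
      obtain rfl : i = v := hi
      obtain rfl : i' = i := hi'
      rw [h2 _ _ _ he he']
    · rw [incident_inr] at hi hi'
      obtain rfl : j = v := hi
      obtain rfl : j' = j := hi'
      rw [h3 _ _ _ he he']

theorem IsSpanning.isMatching {G M : Finset (Edge n)} (h : IsSpanning G M) : IsMatching G M :=
  isMatching_iff.2 ⟨h.sub, fun _ _ _ => h.left, fun _ _ _ => h.right⟩

theorem IsMatching.card_image_fst {G M : Finset (Edge n)} (h : IsMatching G M) :
    (M.image Prod.fst).card = M.card := by
  refine Finset.card_image_of_injOn ?_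
  rintro ⟨i, j⟩ he ⟨i', j'⟩ he' heq
  obtain rfl : i = i' := heq
  rw [(isMatching_iff.1 h).2.1 _ _ _ he he']

theorem IsMatching.card_image_snd {G M : Finset (Edge n)} (h : IsMatching G M) :
    (M.image Prod.snd).card = M.card := by
  refine Finset.card_image_of_injOn ?_
  rintro ⟨i, j⟩ he ⟨i', j'⟩ he' heq
  obtain rfl : j = j' := heq
  rw [(isMatching_iff.1 h).2.2 _ _ _ he he']

/-- The agents of any matching of `G` are among those covered by `M`, and a matching has as many
edges as agents. -/
theorem IsSpanning.isMCM {G M : Finset (Edge n)} (h : IsSpanning G M) : IsMCM G M := by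
  refine ⟨h.isMatching, fun M' h' => ?_⟩
  rw [← h'.card_image_fst, ← h.isMatching.card_image_fst]
  refine Finset.card_le_card fun i hi => ?_
  obtain ⟨⟨i', j⟩, he, rfl⟩ := Finset.mem_image.1 hi
  obtain ⟨j', hj'⟩ := h.agent (h'.1 he)
  exact Finset.mem_image.2 ⟨_, hj', rfl⟩

/-! ## Searches for augmenting paths -/

/-- The state of a search, over the edge set `S`, for an augmenting path relative to `M \ {e₀}`
from the task `e₀.2` to the agent `e₀.1`. The agent `i` has been reached from the task `par i`, and
the search has been continued from the agents in `ex`; `rank` increases along the search tree. -/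
structure SearchInv (M S : Finset (Edge n)) (e₀ : Edge n) (par : Fin n → Option (Fin n))
    (ex : Fin n → Bool) (rank : Fin n → ℕ) : Prop where
  edge : ∀ {i j}, par i = some j → (i, j) ∈ S
  parent : ∀ {i j}, par i = some j → j = e₀.2 ∨
    ∃ i', (i', j) ∈ M ∧ i' ≠ e₀.1 ∧ par i' ≠ none ∧ rank i' < rank i
  rank_le : ∀ {i}, par i ≠ none → rank i ≤ (Finset.univ.filter fun i => ex i = true).card
  start : ∀ {i}, (i, e₀.2) ∈ S → par i ≠ none
  closed : ∀ {i i' j}, ex i' = true → (i', j) ∈ M → (i, j) ∈ S → par i ≠ none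
  ne_root : ∀ {i}, ex i = true → i ≠ e₀.1

theorem SearchInv.init {M S : Finset (Edge n)} {e₀ : Edge n} {par : Fin n → Option (Fin n)}
    {ex : Fin n → Bool} (hpar : ∀ i j, par i = some j ↔ (i, e₀.2) ∈ S ∧ j = e₀.2)
    (hex : ∀ i, ex i = false) : SearchInv M S e₀ par ex 0 where
  edge h := by obtain ⟨h1, rfl⟩ := (hpar _ _).1 h; exact h1
  parent h := .inl ((hpar _ _).1 h).2
  rank_le _ := Nat.zero_le _
  start {i} h h' := by rw [(hpar i e₀.2).2 ⟨h, rfl⟩] at h'; cases h'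
  closed h := by simp [hex] at h
  ne_root h := by simp [hex] at h

/-- Existing parents are never overwritten, so the tree only grows. Newly reached agents become
children of `e.1`, and the edges at its matched task `e.2` are thereby closed. -/
theorem SearchInv.expand {M S : Finset (Edge n)} {e₀ : Edge n} {par par' : Fin n → Option (Fin n)}
    {ex ex' : Fin n → Bool} {rank : Fin n → ℕ} (h : SearchInv M S e₀ par ex rank)
    (left : ∀ {i j j'}, (i, j) ∈ M → (i, j') ∈ M → j = j')
    {e : Edge n} (he : e ∈ M) (hne : e.1 ≠ e₀.1) (hreach : par e.1 ≠ none)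
    (hex : ex e.1 = false) (hex' : ∀ i, ex' i = (ex i || decide (i = e.1)))
    (hpar' : ∀ i, par' i = if par i = none ∧ (i, e.2) ∈ S then some e.2 else par i) :
    ∃ rank', SearchInv M S e₀ par' ex' rank' := by
  have hcard : (Finset.univ.filter fun i => ex' i = true).card =
      (Finset.univ.filter fun i => ex i = true).card + 1 := by
    rw [← Finset.card_insert_of_notMem (a := e.1) (s := Finset.univ.filter fun i => ex i = true)
      (by simp [hex])]
    congr 1
    ext i
    simp [hex', or_comm]
  have hold : ∀ {i}, par i ≠ none → par' i = par i := fun {i} hi => by simp [hpar', hi]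
  have hnew : ∀ {i j}, par' i = some j → par i = some j ∨ par i = none ∧ (i, e.2) ∈ S ∧ j = e.2 := by
    intro i j hij
    rw [hpar'] at hij
    split_ifs at hij with hc
    · exact .inr ⟨hc.1, hc.2, (Option.some.inj hij).symm⟩
    · exact .inl hij
  -- The rank of a new agent is the number of expanded agents, now including `e.1`. That exceeds the
  -- rank of `e.1`, which was at most the previous number. The cap by this number later bounds the
  -- length of an augmentation by `n`.
  refine ⟨fun i => if par i = none then (Finset.univ.filter fun i => ex' i = true).card
    else rank i, ?_, ?_, ?_, ?_, ?_, ?_⟩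
  · intro i j hij
    rcases hnew hij with hij | ⟨-, h2, rfl⟩
    exacts [h.edge hij, h2]
  · intro i j hij
    rcases hnew hij with hij | ⟨h1, h2, rfl⟩
    · rcases h.parent hij with h' | ⟨i', h1, h2, h3, h4⟩
      · exact .inl h'
      · exact .inr ⟨i', h1, h2, by rwa [hold h3], by simpa [h3, hij] using h4⟩
    · refine .inr ⟨e.1, he, hne, by rwa [hold hreach], ?_⟩
      simp only [h1, hreach, if_true, if_false]
      have := h.rank_le hreach
      omega
  · intro i hi
    split_ifs with hc
    · exact le_rfl
    · have := h.rank_le hc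
      omega
  · intro i hi
    rw [hold (h.start hi)]
    exact h.start hi
  · intro i i' j hi' hM hS
    by_cases hc : par i = none
    · have hex1 : ¬ ex i' = true := fun hx => h.closed hx hM hS hc
      have : i' = e.1 := by simpa [hex', hex1] using hi'
      obtain rfl : e.2 = j := by subst this; exact left he hM
      simp [hpar', hc, hS]
    · rwa [hold hc]
  · intro i hi
    rw [hex', Bool.or_eq_true, decide_eq_true_eq] at hi
    rcases hi with hi | rfl
    exacts [h.ne_root hi, hne]

/-! ### Paths, and what the failure or success of a search proves. -/

theorem Joins.symm {e : Edge n} {u v : Vertex n} (h : Joins e u v) : Joins e v u := by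
  rcases h with ⟨h, h'⟩ | ⟨h, h'⟩
  exacts [.inr ⟨h', h⟩, .inl ⟨h', h⟩]

theorem IsPath.symm {E P : Finset (Edge n)} {a b : Vertex n} (h : IsPath E P a b) :
    IsPath E P b a := by
  obtain ⟨hP, l, v, hl, h0, h1, hinj, hjoin, hcov⟩ := h
  refine ⟨hP, l, fun k => v (l - k), hl, by simpa using h1, by simpa using h0, ?_, ?_, ?_⟩
  · intro k hk k' hk' h
    have := hinj _ (Nat.sub_le _ _) _ (Nat.sub_le _ _) h
    omega
  · intro k hk
    obtain ⟨e, he, hj⟩ := hjoin (l - (k + 1)) (by omega)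
    refine ⟨e, he, Joins.symm ?_⟩
    rwa [show l - (k + 1) + 1 = l - k by omega] at hj
  · intro e he
    obtain ⟨k, hk, hj⟩ := hcov e he
    refine ⟨l - (k + 1), by omega, Joins.symm ?_⟩
    dsimp only
    rwa [show l - (l - (k + 1)) = k + 1 by omega, show l - (l - (k + 1) + 1) = k by omega]

theorem joins_inl {e : Edge n} {i : Fin n} {v : Vertex n} (h : Joins e (Sum.inl i) v) :
    e.1 = i ∧ v = Sum.inr e.2 := by
  rcases h with ⟨h, h'⟩ | ⟨h, h'⟩
  · exact ⟨(Sum.inl.inj h).symm, h'⟩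
  · cases h

theorem joins_inr {e : Edge n} {j : Fin n} {v : Vertex n} (h : Joins e (Sum.inr j) v) :
    e.2 = j ∧ v = Sum.inl e.1 := by
  rcases h with ⟨h, h'⟩ | ⟨h, h'⟩
  · cases h
  · exact ⟨(Sum.inr.inj h).symm, h'⟩

theorem Joins.incident_left {e : Edge n} {u v : Vertex n} (h : Joins e u v) : Incident u e := by
  rcases h with ⟨h, -⟩ | ⟨h, -⟩
  exacts [.inl h, .inr h]

theorem Joins.incident_right {e : Edge n} {u v : Vertex n} (h : Joins e u v) : Incident v e := by
  rcases h with ⟨-, h⟩ | ⟨-, h⟩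
  exacts [.inr h, .inl h]

theorem Joins.right_unique {e : Edge n} {u v v' : Vertex n} (h : Joins e u v) (h' : Joins e u v') :
    v = v' := by
  rcases h with ⟨h1, h2⟩ | ⟨h1, h2⟩ <;> rcases h' with ⟨h3, h4⟩ | ⟨h3, h4⟩
  · rw [h2, h4]
  · rw [h1] at h3; cases h3
  · rw [h1] at h3; cases h3
  · rw [h2, h4]

/-- An alternating path from the free task `e₀.2` leaves tasks by unmatched edges and agents by
matched ones. Closure of the search makes every agent on it reached, hence expanded, whereas the
root `e₀.1` is never expanded. -/
theorem SearchInv.not_isPath {M S : Finset (Edge n)} {e₀ : Edge n} {par : Fin n → Option (Fin n)}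
    {ex : Fin n → Bool} {rank : Fin n → ℕ} (h : SearchInv M S e₀ par ex rank)
    (hall : ∀ i, par i ≠ none → ex i = true) {P : Finset (Edge n)}
    (halt : IsAlternating (M \ {e₀}) P) (hfree : IsFree (M \ {e₀}) (Sum.inr e₀.2)) :
    ¬ IsPath S P (Sum.inr e₀.2) (Sum.inl e₀.1) := by
  rintro ⟨hP, l, v, hl, h0, h1, hinj, hjoin, -⟩
  have key : ∀ k ≤ l,
      (∃ j, v k = Sum.inr j ∧ (j = e₀.2 ∨ ∃ i', ex i' = true ∧ (i', j) ∈ M) ∧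
        ∀ e ∈ P, k < l → Joins e (v k) (v (k + 1)) → e ∉ M \ {e₀}) ∨
      (∃ i, v k = Sum.inl i ∧ par i ≠ none ∧
        ∀ e ∈ P, k < l → Joins e (v k) (v (k + 1)) → e ∈ M \ {e₀}) := by
    intro k
    induction k with
    | zero =>
      intro _
      refine .inl ⟨e₀.2, h0, .inl rfl, fun e _ _ hj he => hfree e he ?_⟩
      rw [← h0]
      exact hj.incident_left
    | succ k ih =>
      intro hk
      obtain ⟨e, heP, hje⟩ := hjoin k (by omega)
      -- Consecutive edges of a path differ, so alternation at their common vertex prevents both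
      -- from being matched or both unmatched.
      have hne : ∀ f, k + 1 < l → Joins f (v (k + 1)) (v (k + 1 + 1)) → e ≠ f := by
        rintro f hkl hjf rfl
        have := hinj _ (by omega) _ (by omega) (hje.symm.right_unique hjf)
        omega
      rcases ih (by omega) with ⟨j, hj, hr, hM⟩ | ⟨i, hi, hr, hM⟩
      · have heM := hM e heP (by omega) hje
        obtain ⟨hej, hv⟩ := joins_inr (hj ▸ hje)
        refine .inr ⟨e.1, hv, ?_, fun f hfP hkl hjf => ?_⟩
        · have heS : (e.1, j) ∈ S := hej ▸ hP heP
          rcases hr with rfl | ⟨i', hex, hi'⟩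
          · exact h.start heS
          · exact h.closed hex hi' heS
        · by_contra hfM
          exact hne f hkl hjf ((halt (v (k + 1))).2 e (Finset.mem_sdiff.2 ⟨heP, heM⟩) f
            (Finset.mem_sdiff.2 ⟨hfP, hfM⟩) hje.incident_right hjf.incident_left)
      · have heM := hM e heP (by omega) hje
        obtain ⟨hei, hv⟩ := joins_inl (hi ▸ hje)
        refine .inl ⟨e.2, hv, .inr ⟨i, hall i hr, ?_⟩, fun f hfP hkl hjf hfM => ?_⟩
        · rw [← hei]
          exact (Finset.mem_sdiff.1 heM).1
        · exact hne f hkl hjf ((halt (v (k + 1))).1 e (Finset.mem_inter.2 ⟨heP, heM⟩) f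
            (Finset.mem_inter.2 ⟨hfP, hfM⟩) hje.incident_right hjf.incident_left)
  rcases key l le_rfl with ⟨j, hj, -⟩ | ⟨i, hi, hr, -⟩
  · rw [h1] at hj; cases hj
  · rw [h1] at hi
    exact h.ne_root (hall i hr) (Sum.inl.inj hi).symm

/-- This locates the ends of every augmenting path: a covered vertex can become free only through
the loss of `e₀` itself. -/
theorem IsSpanning.eq_of_isFree {G M S : Finset (Edge n)} (hM : IsSpanning G M) (hS : S ⊆ G)
    {e₀ : Edge n} {v : Vertex n} (hfree : IsFree (M \ {e₀}) v) (hinc : ∃ e ∈ S, Incident v e) :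
    v = Sum.inl e₀.1 ∨ v = Sum.inr e₀.2 := by
  obtain ⟨e, he, hv⟩ := hinc
  have key : ∃ f ∈ M, Incident v f := by
    rcases hv with rfl | rfl
    · obtain ⟨j, hj⟩ := hM.agent (hS he)
      exact ⟨_, hj, .inl rfl⟩
    · obtain ⟨i, hi⟩ := hM.task (hS he)
      exact ⟨_, hi, .inr rfl⟩
  obtain ⟨f, hf, hvf⟩ := key
  have : f = e₀ := by
    by_contra hne
    exact hfree f (by simp [hf, hne]) hvf
  exact this ▸ hvf

theorem SearchInv.not_exists_isAugmenting {G M S : Finset (Edge n)} {e₀ : Edge n}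
    {par : Fin n → Option (Fin n)} {ex : Fin n → Bool} {rank : Fin n → ℕ}
    (h : SearchInv M S e₀ par ex rank) (hM : IsSpanning G M) (hS : S ⊆ G)
    (hall : ∀ i, par i ≠ none → ex i = true) :
    ¬ ∃ P, IsAugmenting S (M \ {e₀}) P := by
  rintro ⟨P, a, b, hpath, halt, ha, hb⟩
  have hinc : ∀ {a b : Vertex n}, IsPath S P a b → (∃ e ∈ S, Incident a e) ∧ a ≠ b := by
    rintro a b ⟨hP, l, v, hl, rfl, rfl, hinj, hjoin, -⟩
    obtain ⟨e, he, hj⟩ := hjoin 0 hl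
    refine ⟨⟨e, hP he, hj.incident_left⟩, fun heq => ?_⟩
    have := hinj 0 (by omega) l le_rfl heq
    omega
  have hne := (hinc hpath).2
  rcases hM.eq_of_isFree hS ha (hinc hpath).1 with rfl | rfl <;>
    rcases hM.eq_of_isFree hS hb (hinc hpath.symm).1 with rfl | rfl
  · exact hne rfl
  · exact h.not_isPath hall halt hb hpath.symm
  · exact h.not_isPath hall halt ha hpath
  · exact hne rfl

/-- The search tree contains a path from every reached agent to the root. -/
theorem SearchInv.exists_chain {M S : Finset (Edge n)} {e₀ : Edge n} {par : Fin n → Option (Fin n)}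
    {ex : Fin n → Bool} {rank : Fin n → ℕ} (h : SearchInv M S e₀ par ex rank) :
    ∀ (r : ℕ) (i : Fin n), rank i = r → par i ≠ none →
      ∃ (k : ℕ) (a t : ℕ → Fin n), a 0 = i ∧ t k = e₀.2 ∧ (∀ m ≤ k, par (a m) = some (t m)) ∧
        (∀ m < k, (a (m + 1), t m) ∈ M ∧ a (m + 1) ≠ e₀.1) ∧
        (∀ m m', m < m' → m' ≤ k → rank (a m') < rank (a m)) := by
  intro r
  induction r using Nat.strong_induction_on with
  | _ r ih =>
    intro i hr hi
    obtain ⟨j, hj⟩ := Option.ne_none_iff_exists'.1 hi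
    rcases h.parent hj with rfl | ⟨i', h1, h2, h3, h4⟩
    · exact ⟨0, fun _ => i, fun _ => e₀.2, rfl, rfl, fun _ _ => hj, fun m hm => by omega,
        fun m m' _ _ => by omega⟩
    · obtain ⟨k, a, t, ha, ht, hpar, hM, hrank⟩ := ih (rank i') (hr ▸ h4) i' rfl h3
      refine ⟨k + 1, fun m => m.casesOn i a, fun m => m.casesOn j t, rfl, ht, ?_, ?_, ?_⟩
      · rintro (_ | m) hm
        exacts [hj, hpar m (by omega)]
      · rintro (_ | m) hm
        · show (a 0, j) ∈ M ∧ a 0 ≠ e₀.1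
          rw [ha]
          exact ⟨h1, h2⟩
        · exact hM m (by omega)
      · rintro (_ | m) (_ | m') hlt hle
        · omega
        · have h0 : rank (a 0) < rank i := ha.symm ▸ h4
          rcases Nat.eq_zero_or_pos m' with rfl | hpos
          · exact h0
          · exact (hrank 0 m' hpos (by omega)).trans h0
        · omega
        · exact hrank m m' (by omega) (by omega)

/-- Following parents from the root gives `a 0, t 0, a 1, t 1, …, a k, t k`, from `e₀.1` to `e₀.2`.
Decreasing ranks make the agents distinct, and the intermediate tasks are then distinct because they
are the partners of distinct agents. -/
theorem SearchInv.exists_isAugmenting {G M S : Finset (Edge n)} {e₀ : Edge n}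
    {par : Fin n → Option (Fin n)} {ex : Fin n → Bool} {rank : Fin n → ℕ}
    (h : SearchInv M S e₀ par ex rank) (hM : IsSpanning G M) (he₀ : e₀ ∈ M)
    (hMS : M \ {e₀} ⊆ S) (hroot : par e₀.1 ≠ none) :
    ∃ P, IsAugmenting S (M \ {e₀}) P := by
  obtain ⟨k, a, t, ha, ht, hpar, hchain, hrank⟩ := h.exists_chain _ e₀.1 rfl hroot
  have hinj : ∀ m ≤ k, ∀ m' ≤ k, a m = a m' → m = m' := by
    intro m hm m' hm' heq
    rcases lt_trichotomy m m' with hlt | rfl | hlt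
    · have := hrank m m' hlt hm'
      rw [heq] at this
      omega
    · rfl
    · have := hrank m' m hlt hm
      rw [heq] at this
      omega
  -- An earlier arrival at `e₀.2` would make its partner `e₀.1` an inner node of the chain, which
  -- `hchain` excludes.
  have htne : ∀ m < k, t m ≠ e₀.2 := by
    intro m hm heq
    have h1 := hchain m hm
    rw [heq] at h1
    exact h1.2 (hM.right h1.1 he₀)
  have htinj : ∀ m ≤ k, ∀ m' ≤ k, t m = t m' → m = m' := by
    intro m hm m' hm' heq
    rcases hm.lt_or_eq with hlt | rfl <;> rcases hm'.lt_or_eq with hlt' | rfl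
    · have h1 := (hchain m hlt).1
      rw [heq] at h1
      have := hinj _ (by omega) _ (by omega) (hM.right h1 (hchain m' hlt').1)
      omega
    · exact absurd (heq.trans ht) (htne m hlt)
    · exact absurd (heq.symm.trans ht) (htne m' hlt')
    · rfl
  have hmate : ∀ m < k, (a (m + 1), t m) ∈ M \ {e₀} := by
    intro m hm
    refine Finset.mem_sdiff.2 ⟨(hchain m hm).1, fun heq => (hchain m hm).2 ?_⟩
    rw [← Finset.mem_singleton.1 heq]
  let P : Finset (Edge n) := (Finset.range (k + 1)).image (fun m => (a m, t m)) ∪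
    (Finset.range k).image (fun m => (a (m + 1), t m))
  have hmemP : ∀ e, e ∈ P ↔ (∃ m ≤ k, (a m, t m) = e) ∨ ∃ m < k, (a (m + 1), t m) = e := by
    intro e
    simp [P]
  -- Agents sit at even positions and tasks at odd ones; with `k + 1` of each the path has `2 * k +
  -- 1` edges.
  let v : ℕ → Vertex n := fun m => if m % 2 = 0 then Sum.inl (a (m / 2)) else Sum.inr (t (m / 2))
  have hv0 : ∀ m, v (2 * m) = Sum.inl (a m) := fun m => by simp [v]
  have hv1 : ∀ m, v (2 * m + 1) = Sum.inr (t m) := fun m => by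
    have h1 : (2 * m + 1) % 2 = 1 := by omega
    have h2 : (2 * m + 1) / 2 = m := by omega
    simp [v, h1, h2]
  have hpar2 : ∀ m : ℕ, ∃ p, m = 2 * p ∨ m = 2 * p + 1 := fun m => ⟨m / 2, by omega⟩
  refine ⟨P, Sum.inl e₀.1, Sum.inr e₀.2, ⟨?_, 2 * k + 1, v, by omega, ?_, ?_, ?_, ?_, ?_⟩,
    ?_, ?_, ?_⟩
  · intro e he
    rcases (hmemP e).1 he with ⟨m, hm, rfl⟩ | ⟨m, hm, rfl⟩
    · exact h.edge (hpar m hm)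
    · exact hMS (hmate m hm)
  · rw [← ha]; exact hv0 0
  · rw [← ht]; exact hv1 k
  · intro m hm m' hm' heq
    obtain ⟨p, rfl | rfl⟩ := hpar2 m <;> obtain ⟨p', rfl | rfl⟩ := hpar2 m'
    · rw [hv0, hv0] at heq
      rw [hinj p (by omega) p' (by omega) (Sum.inl.inj heq)]
    · rw [hv0, hv1] at heq; cases heq
    · rw [hv0, hv1] at heq; cases heq
    · rw [hv1, hv1] at heq
      rw [htinj p (by omega) p' (by omega) (Sum.inr.inj heq)]
  · intro m hm
    obtain ⟨p, rfl | rfl⟩ := hpar2 m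
    · exact ⟨(a p, t p), (hmemP _).2 (.inl ⟨p, by omega, rfl⟩), .inl ⟨hv0 p, hv1 p⟩⟩
    · exact ⟨(a (p + 1), t p), (hmemP _).2 (.inr ⟨p, by omega, rfl⟩), .inr ⟨hv1 p, hv0 (p + 1)⟩⟩
  · intro e he
    rcases (hmemP e).1 he with ⟨m, hm, rfl⟩ | ⟨m, hm, rfl⟩
    · exact ⟨2 * m, by omega, .inl ⟨hv0 m, hv1 m⟩⟩
    · exact ⟨2 * m + 1, by omega, .inr ⟨hv1 m, hv0 (m + 1)⟩⟩
  · intro u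
    constructor
    · intro e he e' he' hu hu'
      rw [Finset.mem_inter, Finset.mem_sdiff] at he he'
      exact hM.isMatching.2 u e he.2.1 e' he'.2.1 hu hu'
    · have hodd : ∀ e ∈ P \ (M \ {e₀}), ∃ m ≤ k, (a m, t m) = e := by
        intro e he
        rw [Finset.mem_sdiff] at he
        rcases (hmemP e).1 he.1 with h' | ⟨m, hm, rfl⟩
        · exact h'
        · exact absurd (hmate m hm) he.2
      intro e he e' he' hu hu'
      obtain ⟨m, hm, rfl⟩ := hodd e he
      obtain ⟨m', hm', rfl⟩ := hodd e' he'
      rcases u with u | u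
      · rw [incident_inl] at hu hu'
        rw [hinj m hm m' hm' (hu.trans hu'.symm)]
      · rw [incident_inr] at hu hu'
        rw [htinj m hm m' hm' (hu.trans hu'.symm)]
  · intro e he hu
    rw [Finset.mem_sdiff, Finset.mem_singleton] at he
    exact he.2 (hM.isMatching.2 _ e he.1 e₀ he₀ hu (.inl rfl))
  · intro e he hu
    rw [Finset.mem_sdiff, Finset.mem_singleton] at he
    exact he.2 (hM.isMatching.2 _ e he.1 e₀ he₀ hu (.inr rfl))

/-! ## Augmentation along the path found by a search -/

/-- The state of the augmentation when it is the turn of agent `i` to change its partner; `m k` is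
the current partner of agent `k`. -/
structure AugInv (M S : Finset (Edge n)) (e₀ : Edge n) (par : Fin n → Option (Fin n))
    (rank : Fin n → ℕ) (m : Fin n → Option (Fin n)) (i : Fin n) : Prop where
  inj : ∀ {k k' j}, k ≠ i → k' ≠ i → m k = some j → m k' = some j → k = k'
  avoid : ∀ {k}, k ≠ i → m k ≠ some e₀.2
  sub : ∀ {k j}, k ≠ i → m k = some j → (k, j) ∈ S
  keep : ∀ {k j}, rank k < rank i → (k, j) ∈ M → m k = some j
  agent : ∀ k, m k ≠ none ↔ ∃ j, (k, j) ∈ M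
  task : ∀ {k j}, (k, j) ∈ M → j ≠ e₀.2 → ∃ k' ≠ i, m k' = some j
  reached : par i ≠ none

/-- The partners `m` form a matching, contained in `S`, that covers the same agents as `M`, and all
tasks that `M` covers. -/
structure IsRematch (M S : Finset (Edge n)) (m : Fin n → Option (Fin n)) : Prop where
  inj : ∀ {k k' j}, m k = some j → m k' = some j → k = k'
  sub : ∀ {k j}, m k = some j → (k, j) ∈ S
  agent : ∀ k, m k ≠ none ↔ ∃ j, (k, j) ∈ M
  task : ∀ {k j}, (k, j) ∈ M → ∃ k', m k' = some j

theorem AugInv.init {G M S : Finset (Edge n)} {e₀ : Edge n} {par : Fin n → Option (Fin n)}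
    {rank : Fin n → ℕ} {m : Fin n → Option (Fin n)} (hM : IsSpanning G M) (he₀ : e₀ ∈ M)
    (hMS : M \ {e₀} ⊆ S) (hroot : par e₀.1 ≠ none) (hm : ∀ i j, m i = some j ↔ (i, j) ∈ M) :
    AugInv M S e₀ par rank m e₀.1 where
  inj _ _ h h' := hM.right ((hm _ _).1 h) ((hm _ _).1 h')
  avoid hk h := hk (hM.right ((hm _ _).1 h) he₀)
  sub hk h := hMS (Finset.mem_sdiff.2 ⟨(hm _ _).1 h, fun heq => hk (by
    rw [← Finset.mem_singleton.1 heq])⟩)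
  keep _ h := (hm _ _).2 h
  agent k := by simp only [Option.ne_none_iff_exists', hm]
  task {k j} h hj := by
    refine ⟨k, ?_, (hm _ _).2 h⟩
    rintro rfl
    exact hj (hM.left h he₀)
  reached := hroot

theorem AugInv.finish {M S : Finset (Edge n)} {e₀ : Edge n} {par : Fin n → Option (Fin n)}
    {ex : Fin n → Bool} {rank : Fin n → ℕ} {m m' : Fin n → Option (Fin n)} {i : Fin n}
    (h : AugInv M S e₀ par rank m i) (hs : SearchInv M S e₀ par ex rank)
    (hcov : ∃ j, (i, j) ∈ M) (hpar : par i = some e₀.2)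
    (hm' : ∀ k, m' k = if k = i then some e₀.2 else m k) : IsRematch M S m' where
  inj {k k' j} hk hk' := by
    rw [hm'] at hk hk'
    split_ifs at hk hk' with h1 h2 h2
    · rw [h1, h2]
    · obtain rfl := Option.some.inj hk
      exact absurd hk' (h.avoid h2)
    · obtain rfl := Option.some.inj hk'
      exact absurd hk (h.avoid h1)
    · exact h.inj h1 h2 hk hk'
  sub {k j} hk := by
    rw [hm'] at hk
    split_ifs at hk with h1
    · obtain rfl := Option.some.inj hk
      rw [h1]
      exact hs.edge hpar
    · exact h.sub h1 hk
  agent k := by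
    rw [hm']
    split_ifs with h1
    · simpa [h1] using hcov
    · exact h.agent k
  task {k j} hk := by
    by_cases hj : j = e₀.2
    · exact ⟨i, by rw [hm', if_pos rfl, hj]⟩
    · obtain ⟨k', h1, h2⟩ := h.task hk hj
      exact ⟨k', by rw [hm', if_neg h1, h2]⟩

/-- Agent `i` takes its parent task from the holder `i'`. Since `i'` has smaller rank it still has
its original partner, so it is the unique holder, and the conflict moves to it. The decreasing rank
ensures termination. -/
theorem AugInv.step {M S : Finset (Edge n)} {e₀ : Edge n} {par : Fin n → Option (Fin n)}
    {ex : Fin n → Bool} {rank : Fin n → ℕ} {m m' : Fin n → Option (Fin n)} {i j : Fin n}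
    (h : AugInv M S e₀ par rank m i) (hs : SearchInv M S e₀ par ex rank)
    (hcov : ∃ j, (i, j) ∈ M) (hpar : par i = some j) (hj : j ≠ e₀.2)
    (hm' : ∀ k, m' k = if k = i then some j else m k) :
    ∃ i', (∀ k, k ≠ i ∧ m k = some j ↔ k = i') ∧ rank i' < rank i ∧
      AugInv M S e₀ par rank m' i' := by
  obtain ⟨i', h1, -, h3, h4⟩ := (hs.parent hpar).resolve_left hj
  have hne : i' ≠ i := by rintro rfl; exact lt_irrefl _ h4
  have hmi' : m i' = some j := h.keep h4 h1
  refine ⟨i', fun k => ⟨fun hk => h.inj hk.1 hne hk.2 hmi', fun hk => hk ▸ ⟨hne, hmi'⟩⟩, h4,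
    ?_, ?_, ?_, ?_, ?_, ?_, h3⟩
  · intro k k' l hk hk' hkl hkl'
    rw [hm'] at hkl hkl'
    split_ifs at hkl hkl' with c1 c2 c2
    · rw [c1, c2]
    · obtain rfl := Option.some.inj hkl
      exact absurd (h.inj c2 hne hkl' hmi') hk'
    · obtain rfl := Option.some.inj hkl'
      exact absurd (h.inj c1 hne hkl hmi') hk
    · exact h.inj c1 c2 hkl hkl'
  · intro k hk hkl
    rw [hm'] at hkl
    split_ifs at hkl with c1
    · exact hj (Option.some.inj hkl)
    · exact h.avoid c1 hkl
  · intro k l hk hkl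
    rw [hm'] at hkl
    split_ifs at hkl with c1
    · obtain rfl := Option.some.inj hkl
      rw [c1]
      exact hs.edge hpar
    · exact h.sub c1 hkl
  · intro k l hk hkl
    have c1 : k ≠ i := by rintro rfl; omega
    rw [hm', if_neg c1]
    exact h.keep (hk.trans h4) hkl
  · intro k
    rw [hm']
    split_ifs with c1
    · simpa [c1] using hcov
    · exact h.agent k
  · intro k l hkl hl
    obtain ⟨k', c1, c2⟩ := h.task hkl hl
    by_cases c3 : k' = i'
    · refine ⟨i, hne.symm, ?_⟩
      rw [hm', if_pos rfl, ← hmi', ← c3, c2]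
    · exact ⟨k', c3, by rw [hm', if_neg c1, c2]⟩

/-- The edges between the agents and their partners. -/
def pairs (m : Fin n → Option (Fin n)) : Finset (Edge n) :=
  Finset.univ.filter fun e => m e.1 = some e.2

theorem mem_pairs {m : Fin n → Option (Fin n)} {i j : Fin n} : (i, j) ∈ pairs m ↔ m i = some j := by
  simp [pairs]

theorem IsRematch.isSpanning {G M S : Finset (Edge n)} {m : Fin n → Option (Fin n)}
    (h : IsRematch M S m) (hM : IsSpanning G M) (hS : S ⊆ G) : IsSpanning G (pairs m) where
  sub := by rintro ⟨i, j⟩ he; exact hS (h.sub (mem_pairs.1 he))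
  left h1 h2 := by
    rw [mem_pairs] at h1 h2
    exact Option.some.inj (h1.symm.trans h2)
  right h1 h2 := by
    rw [mem_pairs] at h1 h2
    exact h.inj h1 h2
  agent {i j} h1 := by
    obtain ⟨j', hj'⟩ := Option.ne_none_iff_exists'.1 ((h.agent i).2 (hM.agent h1))
    exact ⟨j', mem_pairs.2 hj'⟩
  task h1 := by
    obtain ⟨i', hi'⟩ := hM.task h1
    obtain ⟨k, hk⟩ := h.task hi'
    exact ⟨k, mem_pairs.2 hk⟩

/-- The tests in the for-loop use only success or failure, and no exchange is carried out. The
specification of `AugPath` still demands a matching as its value, so the exchange is performed here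
on paper. -/
theorem AugInv.exists_isRematch {G M S : Finset (Edge n)} {e₀ : Edge n}
    {par : Fin n → Option (Fin n)} {ex : Fin n → Bool} {rank : Fin n → ℕ}
    (hs : SearchInv M S e₀ par ex rank) (hM : IsSpanning G M) (hS : S ⊆ G) :
    ∀ (r : ℕ) (m : Fin n → Option (Fin n)) (i : Fin n), rank i = r →
      AugInv M S e₀ par rank m i → ∃ m', IsRematch M S m' := by
  intro r
  induction r using Nat.strong_induction_on with
  | _ r ih =>
    intro m i hr h
    obtain ⟨j, hj⟩ := Option.ne_none_iff_exists'.1 h.reached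
    have hcov := hM.agent (hS (hs.edge hj))
    by_cases hje : j = e₀.2
    · subst hje
      exact ⟨_, h.finish hs hcov hj fun k => rfl⟩
    · obtain ⟨i', -, hlt, h'⟩ := h.step hs hcov hj hje fun k => rfl
      exact ih _ (hr ▸ hlt) _ i' rfl h'

/-! ## The values returned by searches -/

theorem SearchInv.augPathReturns_of_fail {G M S : Finset (Edge n)} {e₀ : Edge n}
    {par : Fin n → Option (Fin n)} {ex : Fin n → Bool} {rank : Fin n → ℕ}
    (h : SearchInv M S e₀ par ex rank) (hM : IsSpanning G M) (hS : S ⊆ G)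
    (hall : ∀ i, par i ≠ none → ex i = true) :
    AugPathReturns G (M \ {e₀}) S (M \ {e₀}) :=
  ⟨fun hP => absurd hP (h.not_exists_isAugmenting hM hS hall), fun _ => rfl⟩

theorem SearchInv.augPathReturns_of_isRematch {G M S : Finset (Edge n)} {e₀ : Edge n}
    {par : Fin n → Option (Fin n)} {ex : Fin n → Bool} {rank : Fin n → ℕ}
    (h : SearchInv M S e₀ par ex rank) (hM : IsSpanning G M) (hS : S ⊆ G) (he₀ : e₀ ∈ M)
    (hMS : M \ {e₀} ⊆ S) (hroot : par e₀.1 ≠ none) {m : Fin n → Option (Fin n)}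
    (hm : IsRematch M S m) :
    AugPathReturns G (M \ {e₀}) S (pairs m) ∧ pairs m ≠ M \ {e₀} := by
  refine ⟨⟨fun _ => ⟨(hm.isSpanning hM hS).isMCM, ?_⟩,
    fun hP => absurd (h.exists_isAugmenting hM he₀ hMS hroot) hP⟩, fun heq => ?_⟩
  · rintro ⟨i, j⟩ he
    exact hm.sub (mem_pairs.1 he)
  -- The new matching covers the agent `e₀.1`, which `M \ {e₀}` leaves free.
  · obtain ⟨j, hj⟩ := Option.ne_none_iff_exists'.1 ((hm.agent e₀.1).2 ⟨e₀.2, he₀⟩)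
    have := mem_pairs.2 hj
    rw [heq, Finset.mem_sdiff] at this
    exact this.2 (by rw [hM.left this.1 he₀, Finset.mem_singleton])

theorem SearchInv.exists_augPathReturns {G M S : Finset (Edge n)} {e₀ : Edge n}
    {par : Fin n → Option (Fin n)} {ex : Fin n → Bool} {rank : Fin n → ℕ}
    (h : SearchInv M S e₀ par ex rank) (hM : IsSpanning G M) (hS : S ⊆ G) (he₀ : e₀ ∈ M)
    (hMS : M \ {e₀} ⊆ S) (hroot : par e₀.1 ≠ none)
    {m : Fin n → Option (Fin n)} (hm : ∀ i j, m i = some j ↔ (i, j) ∈ M) :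
    ∃ R, AugPathReturns G (M \ {e₀}) S R ∧ R ≠ M \ {e₀} := by
  obtain ⟨m', hm'⟩ := AugInv.exists_isRematch h hM hS _ m e₀.1 rfl
    (AugInv.init hM he₀ hMS hroot hm)
  exact ⟨_, h.augPathReturns_of_isRematch hM hS he₀ hMS hroot hm'⟩

/-! ## Searches and augmentations by the network -/

/-- The agents are in phase `p`; together they know the current edge set `E`, the edge set `Eo` at
the beginning of the iteration, the current matching `M`, the solution `L` and the flag `f`. The
agents in `T` are marked as tested, and those in `P` as selected. -/
structure View (w : Edge n → W) (E Eo M L : Finset (Edge n)) (f : Bool) (T P : Fin n → Bool)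
    (p : Phase W n) (x : Config W n) : Prop where
  id : ∀ i, (x i).id = i
  wt : ∀ i j, (x i).wt j = w (i, j)
  edge : ∀ i j, (x i).edge j = true ↔ (i, j) ∈ E
  edgeOld : ∀ i j, (x i).edgeOld j = true ↔ (i, j) ∈ Eo
  mate : ∀ i j, (x i).mate = some j ↔ (i, j) ∈ M
  sel : ∀ i j, (x i).sel = some j ↔ (i, j) ∈ L
  flag : ∀ i, (x i).flag = f
  tested : ∀ i, (x i).tested = T i
  pos : ∀ i, (x i).pos = P i
  phase : ∀ i, (x i).phase = p

/-- `p` is the phase of a search for an augmenting path, over the edge set `S`, after removal of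
the edge `e₀` from the matching. -/
def IsSearchPhase (w : Edge n → W) (E Eo : Finset (Edge n)) (p : Phase W n) (S : Finset (Edge n))
    (e₀ : Edge n) : Prop :=
  (∃ wb, p = .searchCrit e₀ wb ∧ ∀ e, e ∈ S ↔ e ∈ E ∧ e ≠ e₀) ∨
  ∃ b wb, p = .searchPos b wb e₀ ∧ ∀ e, e ∈ S ↔ (e ∈ Eo ∧ w e ≤ wb) ∧ e ≠ e₀

section Search

variable {w : Edge n → W} {E Eo M L S : Finset (Edge n)} {f : Bool} {T P : Fin n → Bool}
  {p : Phase W n} {e₀ : Edge n} {x : Config W n} {Q : Config W n → Prop} {N : ℕ}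

theorem Agent.reach_eq (a : Agent W n) (j : Fin n) : a.reach j =
    { a with parent := if a.parent.isNone && a.usable j then some j else a.parent } := by
  unfold Agent.reach
  split_ifs <;> rfl

theorem View.usable (h : View w E Eo M L f T P p x) (hp : IsSearchPhase w E Eo p S e₀)
    (i j : Fin n) : (x i).usable j = true ↔ (i, j) ∈ S := by
  rcases hp with ⟨wb, rfl, hS⟩ | ⟨b, wb, rfl, hS⟩
  · simp [Agent.usable, h.phase, h.id, h.edge, hS]
  · simp [Agent.usable, h.phase, h.id, h.edgeOld, h.wt, hS]

theorem View.nominee (h : View w E Eo M L f T P p x) (hp : IsSearchPhase w E Eo p S e₀)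
    (i : Fin n) : (x i).nominee =
      if (x i).parent.isSome && !(x i).expanded then (x i).mate else none := by
  rcases hp with ⟨wb, rfl, -⟩ | ⟨b, wb, rfl, -⟩ <;> simp [Agent.nominee, h.phase]

theorem View.update_of_ne (h : View w E Eo M L f T P p x) (hp : IsSearchPhase w E Eo p S e₀)
    {e : Edge n} (he : e.1 ≠ e₀.1) (i : Fin n) (r : W) :
    (x i).update (some (r, e)) = (x i).expand e := by
  rcases hp with ⟨wb, rfl, -⟩ | ⟨b, wb, rfl, -⟩ <;> simp [Agent.update, h.phase, he]

theorem View.reach (h : View w E Eo M L f T P p x) (j : Fin n) :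
    View w E Eo M L f T P p fun i => (x i).reach j := by
  constructor <;> intros <;> simp only [Agent.reach_eq]
  exacts [h.id _, h.wt _ _, h.edge _ _, h.edgeOld _ _, h.mate _ _, h.sel _ _, h.flag _, h.tested _,
    h.pos _, h.phase _]

/-- The agents are in the search phase `p`. -/
structure IsSearching (w : Edge n → W) (E Eo M L : Finset (Edge n)) (f : Bool) (T P : Fin n → Bool)
    (p : Phase W n) (S : Finset (Edge n)) (e₀ : Edge n) (x : Config W n) : Prop where
  view : View w E Eo M L f T P p x
  inv : ∃ rank, SearchInv M S e₀ (fun i => (x i).parent) (fun i => (x i).expanded) rank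

theorem View.isSearching_reach (h : View w E Eo M L f T P p x)
    (hp : IsSearchPhase w E Eo p S e₀) (hpar : ∀ i, (x i).parent = none)
    (hex : ∀ i, (x i).expanded = false) :
    IsSearching w E Eo M L f T P p S e₀ fun i => (x i).reach e₀.2 := by
  refine ⟨h.reach _, 0, SearchInv.init (fun i j => ?_) fun i => ?_⟩
  · by_cases hS : (i, e₀.2) ∈ S
    · simp [Agent.reach_eq, hpar, (h.usable hp i e₀.2).2 hS, hS, eq_comm]
    · have : ¬ (x i).usable e₀.2 = true := fun h' => hS ((h.usable hp i e₀.2).1 h')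
      simp [Agent.reach_eq, hpar, this, hS]
  · simp [Agent.reach_eq, hex]

theorem IsSearching.expand (h : IsSearching w E Eo M L f T P p S e₀ x)
    (hp : IsSearchPhase w E Eo p S e₀) (left : ∀ {i j j'}, (i, j) ∈ M → (i, j') ∈ M → j = j')
    {e : Edge n} (he : e ∈ M) (hne : e.1 ≠ e₀.1) (hreach : (x e.1).parent ≠ none)
    (hex : (x e.1).expanded = false) :
    IsSearching w E Eo M L f T P p S e₀ fun i => (x i).expand e := by
  have hv : View w E Eo M L f T P p fun i =>
      { x i with expanded := (x i).expanded || decide ((x i).id = e.1) } := by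
    have h := h.view
    exact ⟨h.id, h.wt, h.edge, h.edgeOld, h.mate, h.sel, h.flag, h.tested, h.pos, h.phase⟩
  obtain ⟨rank, hinv⟩ := h.inv
  refine ⟨hv.reach e.2, hinv.expand left he hne hreach hex (fun i => ?_) fun i => ?_⟩
  · simp [Agent.expand, Agent.reach_eq, h.view.id]
  · have hu := hv.usable hp i e.2
    by_cases hS : (i, e.2) ∈ S
    · simp only [Agent.expand, Agent.reach_eq, hu.2 hS, hS, Bool.and_true, and_true,
        Option.isNone_iff_eq_none]
    · have hu' := Bool.eq_false_iff.2 fun h' => hS (hu.1 h')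
      simp [Agent.expand, Agent.reach_eq, hu', hS]

/-- A search fails or succeeds after at most `n + 1` rounds. -/
theorem IsSearching.within (hp : IsSearchPhase w E Eo p S e₀) (hM : IsSpanning Eo M)
    (hS : S ⊆ Eo) (he₀ : e₀ ∈ M)
    (hfail : ∀ x, IsSearching w E Eo M L f T P p S e₀ x →
      (∀ i, (x i).parent ≠ none → (x i).expanded = true) →
      ∀ y : Config W n, (∀ i, y i = (x i).update none) → Within Q N y)
    (hsucc : ∀ x, IsSearching w E Eo M L f T P p S e₀ x → (x e₀.1).parent ≠ none →
      ∀ (y : Config W n) (r : W), (∀ i, y i = (x i).update (some (r, e₀))) → Within Q N y)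
    (hx : IsSearching w E Eo M L f T P p S e₀ x) : Within Q (N + n + 1) x := by
  -- The measure `c` bounds the number of agents not yet expanded; every round that does not end the
  -- search expands one more.
  suffices H : ∀ (c : ℕ) (x : Config W n), IsSearching w E Eo M L f T P p S e₀ x →
      (Finset.univ.filter fun i => (x i).expanded = false).card ≤ c → Within Q (N + c + 1) x from
    H n x hx ((Finset.card_le_univ _).trans_eq (Fintype.card_fin n))
  intro c
  induction c with
  | zero =>
    intro x hx hc
    have hex : ∀ i, (x i).expanded = true := by
      intro i
      by_contra hi
      rw [Nat.le_zero, Finset.card_eq_zero] at hc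
      have : i ∈ Finset.univ.filter fun i => (x i).expanded = false := by simpa using hi
      simp [hc] at this
    refine .step _ _ fun y ⟨r, hr, hy⟩ => ?_
    rcases hr with ⟨rfl, hr⟩ | ⟨i, j, hij, -, -⟩
    · exact hfail x hx (fun i _ => hex i) y hy
    · rw [hx.view.nominee hp] at hij
      simp [hex] at hij
  | succ c ih =>
    intro x hx hc
    obtain ⟨rank, hinv⟩ := hx.inv
    refine .step _ _ fun y ⟨r, hr, hy⟩ => ?_
    rcases hr with ⟨rfl, hr⟩ | ⟨i, j, hij, rfl, -⟩
    · refine (hfail x hx (fun i hi => ?_) y hy).mono (by omega)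
      obtain ⟨j, hj⟩ := Option.ne_none_iff_exists'.1 hi
      -- A reached agent has an edge of `Eo` and is therefore matched, so if it were unexpanded it
      -- would have nominated.
      obtain ⟨j', hj'⟩ := hM.agent (hS (hinv.edge hj))
      by_contra hex
      have := hr i
      rw [hx.view.nominee hp, (hx.view.mate i j').2 hj'] at this
      simp [hj, hex] at this
    · rw [hx.view.nominee hp] at hij
      split_ifs at hij with hc'
      rw [Bool.and_eq_true, Option.isSome_iff_ne_none, Bool.not_eq_true'] at hc'
      have hijM := (hx.view.mate i j).1 hij
      rw [hx.view.id] at hy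
      by_cases hi : i = e₀.1
      · subst hi
        obtain rfl := hM.left hijM he₀
        exact (hsucc x hx hc'.1 y _ hy).mono (by omega)
      · have hxy : y = fun k => (x k).expand (i, j) :=
          funext fun k => (hy k).trans (hx.view.update_of_ne hp hi k _)
        rw [hxy]
        refine ih _ (hx.expand hp hM.left hijM hi hc'.1 hc'.2) ?_
        refine Nat.le_of_lt_succ (lt_of_lt_of_le (Finset.card_lt_card ?_) hc)
        refine Finset.ssubset_iff_of_subset (fun k hk => ?_) |>.2 ⟨i, by simp [hc'.2], ?_⟩
        · simp [Agent.expand, Agent.reach_eq] at hk ⊢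
          exact hk.1
        · simp [Agent.expand, Agent.reach_eq, hx.view.id]

/-- An augmentation ends after at most `n + 1` rounds. -/
theorem AugInv.within {par : Fin n → Option (Fin n)} {ex : Fin n → Bool} {rank : Fin n → ℕ}
    (hs : SearchInv M S e₀ par ex rank) (hM : IsSpanning Eo M) (hS : S ⊆ Eo)
    (hdone : ∀ (m : Fin n → Option (Fin n)) (y : Config W n), IsRematch M S m →
      View w E Eo (pairs m) L f T P .pick y → Within Q N y)
    {m : Fin n → Option (Fin n)} {i : Fin n} (h : AugInv M S e₀ par rank m i)
    (hx : View w E Eo (pairs m) L f T P (.augment e₀) x) (hpar : ∀ k, (x k).parent = par k)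
    (hact : ∀ k, (x k).active = decide (k = i)) : Within Q (N + n + 1) x := by
  -- Only the agent whose turn it is nominates, and the turn passes to smaller ranks; ranks are at
  -- most `n`.
  suffices H : ∀ (r : ℕ) (x : Config W n) (m : Fin n → Option (Fin n)) (i : Fin n), rank i ≤ r →
      AugInv M S e₀ par rank m i → View w E Eo (pairs m) L f T P (.augment e₀) x →
      (∀ k, (x k).parent = par k) → (∀ k, (x k).active = decide (k = i)) →
      Within Q (N + r + 1) x from
    H n x m i ((hs.rank_le h.reached).trans ((Finset.card_le_univ _).trans_eq
      (Fintype.card_fin n))) h hx hpar hact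
  intro r
  induction r using Nat.strong_induction_on with
  | _ r ih =>
    intro x m i hr h hx hpar hact
    obtain ⟨j, hj⟩ := Option.ne_none_iff_exists'.1 h.reached
    have hcov := hM.agent (hS (hs.edge hj))
    have hnom : ∀ k, (x k).nominee = if k = i then par k else none := by
      intro k
      simp [Agent.nominee, hx.phase, hact, hpar]
    refine .step _ _ fun y ⟨q, hq, hy⟩ => ?_
    rcases hq with ⟨rfl, hq⟩ | ⟨i', j', hij, rfl, -⟩
    · have := hq i
      rw [hnom, if_pos rfl, hj] at this
      cases this
    · rw [hnom] at hij
      split_ifs at hij with hi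
      subst hi
      obtain rfl : j' = j := Option.some.inj (hij.symm.trans hj)
      have hm : ∀ k, (x k).mate = m k := by
        intro k
        ext l
        rw [hx.mate, mem_pairs]
      set m' : Fin n → Option (Fin n) := fun k => if k = i' then some j' else m k with hm'
      have hyk : ∀ k, y k = { x k with
          mate := m' k
          active := decide (j' ≠ e₀.2) && decide (k ≠ i') && decide (m k = some j')
          phase := if j' = e₀.2 then .pick else .augment e₀ } := by
        intro k
        rw [hy k]
        simp only [Agent.update, hx.phase, hx.id, hm, hm']
      have hview : View w E Eo (pairs m') L f T P
          (if j' = e₀.2 then .pick else .augment e₀) y := by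
        constructor <;> intros <;> simp only [hyk]
        exacts [hx.id _, hx.wt _ _, hx.edge _ _, hx.edgeOld _ _, mem_pairs.symm, hx.sel _ _,
          hx.flag _, hx.tested _, hx.pos _]
      by_cases hje : j' = e₀.2
      · rw [if_pos hje] at hview
        refine (hdone m' y (h.finish hs hcov (hje ▸ hj) fun k => ?_) hview).mono (by omega)
        rw [hm', ← hje]
      · rw [if_neg hje] at hview
        obtain ⟨i, hi, hlt, h'⟩ := h.step hs hcov hj hje fun k => rfl
        refine (ih (rank i) (by omega) y m' i le_rfl h' hview (fun k => ?_)
          fun k => ?_).mono (by omega)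
        · rw [hyk]; exact hpar k
        · rw [hyk]
          simp only [hje, not_false_eq_true, ne_eq, decide_true, Bool.true_and, ← Bool.decide_and]
          exact decide_eq_decide.2 (hi k)

end Search

/-! ## The for-loop over the edges of the matching -/

/-- The mark of an edge is consistent with some value returned by `AugPath`. -/
def IsMarkCorrect (w : Edge n → W) (Eo M : Finset (Edge n)) (e : Edge n) (marked : Bool) : Prop :=
  ∃ R, AugPathReturns Eo (M \ {e}) (sublevel w Eo M \ {e}) R ∧ (marked = true ↔ R = M \ {e})

section ForLoop

variable {w : Edge n → W} {E Eo M L : Finset (Edge n)} {f : Bool} {b : Edge n}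
  {Q : Config W n → Prop} {N : ℕ}

theorem mem_heaviest {e : Edge n} : e ∈ heaviest w M ↔ e ∈ M ∧ ∀ e' ∈ M, w e' ≤ w e := by
  simp [heaviest]

theorem mem_sublevel (hb : b ∈ heaviest w M) {e : Edge n} :
    e ∈ sublevel w Eo M ↔ e ∈ Eo ∧ w e ≤ w b := by
  rw [mem_heaviest] at hb
  simp only [sublevel, Finset.mem_filter, and_congr_right_iff]
  exact fun _ => ⟨fun ⟨e', he', h⟩ => h.trans (hb.2 e' he'), fun h => ⟨b, hb.1, h⟩⟩

theorem mem_strictSublevel (hb : b ∈ heaviest w M) {e : Edge n} :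
    e ∈ strictSublevel w Eo M ↔ e ∈ Eo ∧ w e < w b := by
  rw [mem_heaviest] at hb
  simp only [strictSublevel, Finset.mem_filter, and_congr_right_iff]
  exact fun _ => ⟨fun ⟨e', he', h⟩ => h.trans_le (hb.2 e' he'), fun h => ⟨b, hb.1, h⟩⟩

/-- The for-loop ends after at most `n * (n + 2) + 1` rounds. -/
theorem within_forLoop (hM : IsSpanning Eo M) (hb : b ∈ heaviest w M)
    (hdone : ∀ (T P : Fin n → Bool) (y : Config W n),
      (∀ e ∈ M, IsMarkCorrect w Eo M e (P e.1)) →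
      View w E Eo M L f T P (.checkTop b (w b)) y → Within Q N y)
    {T P : Fin n → Bool} {x : Config W n}
    (hnew : ∀ e ∈ M, T e.1 = false → P e.1 = false)
    (hmark : ∀ e ∈ M, T e.1 = true → IsMarkCorrect w Eo M e (P e.1))
    (hx : View w E Eo M L f T P (.nextEdge b (w b)) x) : Within Q (N + n * (n + 2) + 1) x := by
  suffices H : ∀ (c : ℕ) (T P : Fin n → Bool) (x : Config W n),
      (∀ e ∈ M, T e.1 = false → P e.1 = false) →
      (∀ e ∈ M, T e.1 = true → IsMarkCorrect w Eo M e (P e.1)) →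
      View w E Eo M L f T P (.nextEdge b (w b)) x →
      (Finset.univ.filter fun i => T i = false).card ≤ c → Within Q (N + c * (n + 2) + 1) x from
    H n T P x hnew hmark hx ((Finset.card_le_univ _).trans_eq (Fintype.card_fin n))
  intro c
  induction c with
  | zero =>
    intro T P x hnew hmark hx hc
    have hT : ∀ i, T i = true := by
      intro i
      by_contra hi
      rw [Nat.le_zero, Finset.card_eq_zero] at hc
      have : i ∈ Finset.univ.filter fun i => T i = false := by simpa using hi
      simp [hc] at this
    refine .step _ _ fun y ⟨r, hr, hy⟩ => ?_
    rcases hr with ⟨rfl, hr⟩ | ⟨i, j, hij, -, -⟩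
    · refine (hdone T P y (fun e he => hmark e he (hT _)) ?_).mono (by omega)
      constructor <;> intros <;> simp only [hy, Agent.update, hx.phase]
      exacts [hx.id _, hx.wt _ _, hx.edge _ _, hx.edgeOld _ _, hx.mate _ _, hx.sel _ _,
        hx.flag _, hx.tested _, hx.pos _]
    · simp [Agent.nominee, hx.phase, hx.tested, hT] at hij
  | succ c ih =>
    intro T P x hnew hmark hx hc
    refine .step _ _ fun y ⟨r, hr, hy⟩ => ?_
    rcases hr with ⟨rfl, hr⟩ | ⟨i, j, hij, rfl, -⟩
    · refine (hdone T P y (fun e he => hmark e he ?_) ?_).mono (by omega)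
      · by_contra hT
        have := hr e.1
        simp [Agent.nominee, hx.phase, hx.tested, hT, (hx.mate e.1 e.2).2 he] at this
      · constructor <;> intros <;> simp only [hy, Agent.update, hx.phase]
        exacts [hx.id _, hx.wt _ _, hx.edge _ _, hx.edgeOld _ _, hx.mate _ _, hx.sel _ _,
          hx.flag _, hx.tested _, hx.pos _]
    · have hnom : (if (!T i) = true then (x i).mate else none) = some j := by
        rw [← hij]
        simp [Agent.nominee, hx.phase, hx.tested]
      clear hij
      split_ifs at hnom with hTi
      rw [Bool.not_eq_true'] at hTi
      have he : (i, j) ∈ M := (hx.mate i j).1 hnom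
      rw [hx.id] at hy
      set T' : Fin n → Bool := fun k => T k || decide (k = i) with hT'
      have hT'old : ∀ e ∈ M, e ≠ (i, j) → T' e.1 = T e.1 ∧ e.1 ≠ i := by
        rintro ⟨k, l⟩ hkl hne
        have : k ≠ i := by
          rintro rfl
          exact hne (by rw [hM.left hkl he])
        simp [hT', this]
      have hcard : (Finset.univ.filter fun k => T' k = false).card ≤ c := by
        refine Nat.le_of_lt_succ (lt_of_lt_of_le (Finset.card_lt_card ?_) hc)
        refine Finset.ssubset_iff_of_subset (fun k hk => ?_) |>.2 ⟨i, by simp [hTi], by simp [hT']⟩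
        simp [hT'] at hk ⊢
        exact hk.1
      -- This search uses the edge set from before the shrinking, with weights up to and including
      -- `w b`.
      set S := sublevel w Eo M \ {(i, j)} with hS
      have hSE : S ⊆ Eo := Finset.sdiff_subset.trans (Finset.filter_subset _ _)
      have hMS : M \ {(i, j)} ⊆ S := by
        intro e heM
        rw [Finset.mem_sdiff] at heM
        rw [hS, Finset.mem_sdiff, mem_sublevel hb]
        exact ⟨⟨hM.sub heM.1, (mem_heaviest.1 hb).2 e heM.1⟩, heM.2⟩
      set p : Phase W n := .searchPos b (w b) (i, j) with hpdef
      have hp : IsSearchPhase w E Eo p S (i, j) :=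
        .inr ⟨b, w b, rfl, fun e => by
          rw [hS, Finset.mem_sdiff, mem_sublevel hb, Finset.mem_singleton]⟩
      have hx' : View w E Eo M L f T' P p (fun k =>
          { x k with
            tested := (x k).tested || decide ((x k).id = i)
            phase := p, parent := none, expanded := false }) := by
        constructor <;> intros <;> dsimp only
        exacts [hx.id _, hx.wt _ _, hx.edge _ _, hx.edgeOld _ _, hx.mate _ _, hx.sel _ _,
          hx.flag _, by rw [hx.tested, hx.id], hx.pos _]
      have hy' : y = fun k => Agent.reach { x k with
            tested := (x k).tested || decide ((x k).id = i)
            phase := p, parent := none, expanded := false } j := by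
        funext k
        rw [hy k]
        simp only [Agent.update, hx.phase, Agent.startSearch, hpdef]
      rw [hy']
      -- One test costs `n + 2` rounds: one to select the edge, already spent, and at most `n + 1`
      -- for the search.
      have hrew : N + (c + 1) * (n + 2) = (N + c * (n + 2) + 1) + n + 1 := by ring
      rw [hrew]
      refine IsSearching.within hp hM hSE he (fun z hz hall v hv => ?_)
        (fun z hz hroot v r hv => ?_) (hx'.isSearching_reach hp (fun _ => rfl) fun _ => rfl)
      · obtain ⟨rank, hinv⟩ := hz.inv
        refine ih T' (fun k => P k || decide (k = i)) v ?_ ?_ ?_ hcard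
        · intro e heM heT
          by_cases hne : e = (i, j)
          · subst hne
            simp [hT'] at heT
          · obtain ⟨h1, h2⟩ := hT'old e heM hne
            simp [h2, hnew e heM (h1 ▸ heT)]
        · intro e heM heT
          by_cases hne : e = (i, j)
          · subst hne
            exact ⟨_, hinv.augPathReturns_of_fail hM hSE hall, by simp⟩
          · obtain ⟨h1, h2⟩ := hT'old e heM hne
            simpa [h2] using hmark e heM (h1 ▸ heT)
        · have hz := hz.view
          constructor <;> intros <;> simp only [hv, Agent.update, hz.phase, hpdef]
          exacts [hz.id _, hz.wt _ _, hz.edge _ _, hz.edgeOld _ _, hz.mate _ _, hz.sel _ _,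
            hz.flag _, hz.tested _, by rw [hz.pos, hz.id]]
      · obtain ⟨rank, hinv⟩ := hz.inv
        refine ih T' P v ?_ ?_ ?_ hcard
        · intro e heM heT
          by_cases hne : e = (i, j)
          · subst hne
            simp [hT'] at heT
          · exact hnew e heM ((hT'old e heM hne).1 ▸ heT)
        · intro e heM heT
          by_cases hne : e = (i, j)
          · subst hne
            -- On success the agent keeps the mark it had while untested, which is `false` by
            -- `hnew`.
            obtain ⟨R, hR, hne⟩ := hinv.exists_augPathReturns hM hSE he hMS hroot hz.view.mate
            exact ⟨R, hR, by simp [hnew _ he hTi, hne]⟩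
          · exact hmark e heM ((hT'old e heM hne).1 ▸ heT)
        · have hz := hz.view
          constructor <;> intros <;> simp only [hv, Agent.update, hz.phase, hpdef, if_true]
          exacts [hz.id _, hz.wt _ _, hz.edge _ _, hz.edgeOld _ _, hz.mate _ _, hz.sel _ _,
            hz.flag _, hz.tested _, hz.pos _]

end ForLoop

/-! ## Iterations of the while-loop -/

/-- The invariant of the while-loop: the current matching covers the current graph. -/
structure AlgState.IsValid (s : AlgState n) : Prop where
  sub : s.cur ⊆ s.es
  left : ∀ {i j j'}, (i, j) ∈ s.cur → (i, j') ∈ s.cur → j = j'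
  right : ∀ {i i' j}, (i, j) ∈ s.cur → (i', j) ∈ s.cur → i = i'
  mem_vs : ∀ {i j}, (i, j) ∈ s.es → Sum.inl i ∈ s.vs ∧ Sum.inr j ∈ s.vs
  agent : ∀ {i}, Sum.inl i ∈ s.vs → ∃ j, (i, j) ∈ s.cur
  task : ∀ {j}, Sum.inr j ∈ s.vs → ∃ i, (i, j) ∈ s.cur
  sol : ∀ {i j}, (i, j) ∈ s.sol → Sum.inl i ∉ s.vs

theorem AlgState.IsValid.isSpanning {s : AlgState n} (h : s.IsValid) : IsSpanning s.es s.cur where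
  sub := h.sub
  left := h.left
  right := h.right
  agent he := h.agent (h.mem_vs he).1
  task he := h.task (h.mem_vs he).2

theorem AlgState.isValid_init {E M₀ : Finset (Edge n)} (hM : IsMatching E M₀)
    (hcard : M₀.card = n) : (AlgState.init E M₀).IsValid where
  sub := hM.1
  left := (isMatching_iff.1 hM).2.1 _ _ _
  right := (isMatching_iff.1 hM).2.2 _ _ _
  mem_vs _ := ⟨Finset.mem_univ _, Finset.mem_univ _⟩
  agent {i} _ := by
    have : M₀.image Prod.fst = Finset.univ := by
      rw [← Finset.card_eq_iff_eq_univ, hM.card_image_fst, hcard, Fintype.card_fin]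
    obtain ⟨⟨i', j⟩, he, rfl⟩ := Finset.mem_image.1 (this ▸ Finset.mem_univ i)
    exact ⟨j, he⟩
  task {j} _ := by
    have : M₀.image Prod.snd = Finset.univ := by
      rw [← Finset.card_eq_iff_eq_univ, hM.card_image_snd, hcard, Fintype.card_fin]
    obtain ⟨⟨i, j'⟩, he, rfl⟩ := Finset.mem_image.1 (this ▸ Finset.mem_univ j)
    exact ⟨i, he⟩
  sol h := by simp [AlgState.init] at h

theorem AlgState.mem_remove_es {s : AlgState n} {K : Finset (Edge n)} {i j : Fin n}
    (h : s.IsValid) : (i, j) ∈ (s.remove K).es ↔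
      (i, j) ∈ s.es ∧ (∀ e ∈ K, e.1 ≠ i) ∧ ∀ e ∈ K, e.2 ≠ j := by
  simp only [AlgState.remove, Finset.mem_filter, Finset.mem_sdiff, Finset.mem_union,
    Finset.mem_image, Sum.inl.injEq, Sum.inr.injEq, reduceCtorEq, and_false, exists_false,
    or_false, false_or]
  constructor
  · rintro ⟨h1, ⟨-, h2⟩, -, h3⟩
    exact ⟨h1, fun e he hi => h2 ⟨e, he, hi⟩, fun e he hj => h3 ⟨e, he, hj⟩⟩
  · rintro ⟨h1, h2, h3⟩
    exact ⟨h1, ⟨(h.mem_vs h1).1, fun ⟨e, he, hi⟩ => h2 e he hi⟩, (h.mem_vs h1).2,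
      fun ⟨e, he, hj⟩ => h3 e he hj⟩

theorem AlgState.inl_mem_remove_vs {s : AlgState n} {K : Finset (Edge n)} {i : Fin n} :
    Sum.inl i ∈ (s.remove K).vs ↔ Sum.inl i ∈ s.vs ∧ ∀ e ∈ K, e.1 ≠ i := by
  simp only [AlgState.remove, Finset.mem_sdiff, Finset.mem_union, Finset.mem_image, Sum.inl.injEq,
    reduceCtorEq, and_false, exists_false, or_false, not_exists, not_and, ne_eq]

theorem AlgState.inr_mem_remove_vs {s : AlgState n} {K : Finset (Edge n)} {j : Fin n} :
    Sum.inr j ∈ (s.remove K).vs ↔ Sum.inr j ∈ s.vs ∧ ∀ e ∈ K, e.2 ≠ j := by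
  simp only [AlgState.remove, Finset.mem_sdiff, Finset.mem_union, Finset.mem_image, Sum.inr.injEq,
    reduceCtorEq, and_false, exists_false, false_or, not_exists, not_and, ne_eq]

theorem AlgState.IsValid.remove {s : AlgState n} (h : s.IsValid) {K : Finset (Edge n)}
    (hK : K ⊆ s.cur) : (s.remove K).IsValid where
  sub := by
    rintro ⟨i, j⟩ he
    obtain ⟨he, heK⟩ := Finset.mem_sdiff.1 he
    refine (mem_remove_es h).2 ⟨h.sub he, ?_, ?_⟩
    · rintro ⟨i', j'⟩ he' rfl
      exact heK (by rwa [h.left he (hK he')])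
    · rintro ⟨i', j'⟩ he' rfl
      exact heK (by rwa [h.right he (hK he')])
  left h1 h2 := h.left (Finset.mem_sdiff.1 h1).1 (Finset.mem_sdiff.1 h2).1
  right h1 h2 := h.right (Finset.mem_sdiff.1 h1).1 (Finset.mem_sdiff.1 h2).1
  mem_vs he := by
    obtain ⟨h1, h2, h3⟩ := (mem_remove_es h).1 he
    exact ⟨inl_mem_remove_vs.2 ⟨(h.mem_vs h1).1, h2⟩, inr_mem_remove_vs.2 ⟨(h.mem_vs h1).2, h3⟩⟩
  agent hi := by
    obtain ⟨h1, h2⟩ := inl_mem_remove_vs.1 hi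
    obtain ⟨j, hj⟩ := h.agent h1
    exact ⟨j, Finset.mem_sdiff.2 ⟨hj, fun hK' => h2 _ hK' rfl⟩⟩
  task hj := by
    obtain ⟨h1, h2⟩ := inr_mem_remove_vs.1 hj
    obtain ⟨i, hi⟩ := h.task h1
    exact ⟨i, Finset.mem_sdiff.2 ⟨hi, fun hK' => h2 _ hK' rfl⟩⟩
  sol he hi := by
    obtain ⟨h1, h2⟩ := inl_mem_remove_vs.1 hi
    rcases Finset.mem_union.1 he with he | he
    exacts [h.sol he h1, h2 _ he rfl]

theorem AlgState.remove_empty {s : AlgState n} (h : s.IsValid) : s.remove ∅ = s := by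
  have hes : (s.es.filter fun e => Sum.inl e.1 ∈ s.vs ∧ Sum.inr e.2 ∈ s.vs) = s.es :=
    Finset.filter_true_of_mem fun e he => h.mem_vs he
  cases s
  simpa [AlgState.remove] using hes

/-- The algorithm deletes a set of edges at once and the network one edge per round; this identity
reconciles the two. -/
theorem AlgState.remove_remove {s : AlgState n} {K K' : Finset (Edge n)} :
    (s.remove K).remove K' = s.remove (K ∪ K') := by
  have hvs : (s.remove K).vs \ (K'.image (fun e => Sum.inl e.1) ∪ K'.image (fun e => Sum.inr e.2))
      = (s.remove (K ∪ K')).vs := by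
    ext v
    simp only [AlgState.remove, Finset.mem_sdiff, Finset.mem_union, Finset.image_union]
    tauto
  have hes : ((s.remove K).remove K').es = (s.remove (K ∪ K')).es := by
    ext e
    have h1 : e ∈ ((s.remove K).remove K').es ↔ e ∈ (s.remove K).es ∧
        Sum.inl e.1 ∈ (s.remove (K ∪ K')).vs ∧ Sum.inr e.2 ∈ (s.remove (K ∪ K')).vs := by
      rw [← hvs]
      exact Finset.mem_filter
    rw [h1]
    have h2 : ∀ L, e ∈ (s.remove L).es ↔ e ∈ s.es ∧
        Sum.inl e.1 ∈ (s.remove L).vs ∧ Sum.inr e.2 ∈ (s.remove L).vs :=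
      fun L => Finset.mem_filter
    rw [h2, h2]
    constructor
    · rintro ⟨⟨h, -⟩, h'⟩
      exact ⟨h, h'⟩
    · rintro ⟨h, h'⟩
      refine ⟨⟨h, ?_⟩, h'⟩
      rw [← hvs] at h'
      exact ⟨(Finset.mem_sdiff.1 h'.1).1, (Finset.mem_sdiff.1 h'.2).1⟩
  have hcur : (s.cur \ K) \ K' = s.cur \ (K ∪ K') := by
    rw [sdiff_sdiff_left, Finset.sup_eq_union]
  have hsol : s.sol ∪ K ∪ K' = s.sol ∪ (K ∪ K') := Finset.union_assoc _ _ _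
  change AlgState.mk _ _ _ _ _ = AlgState.mk _ _ _ _ _
  exact congr (congr (congr (congr (congrArg AlgState.mk hvs) hes) hcur) hsol) rfl

section Iteration

variable {w : Edge n → W} {Q : Config W n → Prop} {N : ℕ}

/-- The removal of the selected edges ends after at most `n + 1` rounds. -/
theorem within_prune {s : AlgState n} (hs : s.IsValid) {K : Finset (Edge n)} (hK : K ⊆ s.cur)
    {Eo : Finset (Edge n)} (hdone : ∀ (T P : Fin n → Bool) (y : Config W n),
      View w (s.remove K).es Eo (s.remove K).cur (s.remove K).sol (s.remove K).flag T P .pick y →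
      Within Q N y)
    {T P : Fin n → Bool} {x : Config W n} (hP : ∀ e ∈ s.cur, P e.1 = true ↔ e ∈ K)
    (hx : View w s.es Eo s.cur s.sol s.flag T P .prune x) : Within Q (N + n + 1) x := by
  suffices H : ∀ (c : ℕ) (s : AlgState n) (K : Finset (Edge n)) (P : Fin n → Bool)
      (x : Config W n), K.card ≤ c → s.IsValid → K ⊆ s.cur →
      (∀ (T P : Fin n → Bool) (y : Config W n),
        View w (s.remove K).es Eo (s.remove K).cur (s.remove K).sol (s.remove K).flag T P .pick y →
        Within Q N y) →
      (∀ e ∈ s.cur, P e.1 = true ↔ e ∈ K) →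
      View w s.es Eo s.cur s.sol s.flag T P .prune x → Within Q (N + c + 1) x by
    refine H n s K P x ?_ hs hK hdone hP hx
    refine (Finset.card_le_card hK).trans ?_
    rw [← hs.isSpanning.isMatching.card_image_fst]
    exact (Finset.card_le_univ _).trans_eq (Fintype.card_fin n)
  intro c
  induction c with
  | zero =>
    intro s K P x hc hs hK hdone hP hx
    obtain rfl : K = ∅ := Finset.card_eq_zero.1 (Nat.le_zero.1 hc)
    rw [AlgState.remove_empty hs] at hdone
    refine .step _ _ fun y ⟨r, hr, hy⟩ => ?_
    rcases hr with ⟨rfl, hr⟩ | ⟨i, j, hij, -, -⟩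
    · refine (hdone T P y ?_).mono (by omega)
      constructor <;> intros <;> simp only [hy, Agent.update, hx.phase]
      exacts [hx.id _, hx.wt _ _, hx.edge _ _, hx.edgeOld _ _, hx.mate _ _, hx.sel _ _,
        hx.flag _, hx.tested _, hx.pos _]
    · simp only [Agent.nominee, hx.phase, hx.pos] at hij
      split_ifs at hij with hPi
      have := (hP _ ((hx.mate i j).1 hij)).1 hPi
      simp at this
  | succ c ih =>
    intro s K P x hc hs hK hdone hP hx
    refine .step _ _ fun y ⟨r, hr, hy⟩ => ?_
    rcases hr with ⟨rfl, hr⟩ | ⟨i, j, hij, rfl, -⟩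
    · obtain rfl : K = ∅ := by
        refine Finset.eq_empty_of_forall_notMem fun e he => ?_
        have := hr e.1
        simp [Agent.nominee, hx.phase, hx.pos, (hP e (hK he)).2 he,
          (hx.mate e.1 e.2).2 (hK he)] at this
      rw [AlgState.remove_empty hs] at hdone
      refine (hdone T P y ?_).mono (by omega)
      constructor <;> intros <;> simp only [hy, Agent.update, hx.phase]
      exacts [hx.id _, hx.wt _ _, hx.edge _ _, hx.edgeOld _ _, hx.mate _ _, hx.sel _ _,
        hx.flag _, hx.tested _, hx.pos _]
    · simp only [Agent.nominee, hx.phase, hx.pos] at hij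
      split_ifs at hij with hPi
      have hcur : (i, j) ∈ s.cur := (hx.mate i j).1 hij
      have hiK : (i, j) ∈ K := (hP _ hcur).1 hPi
      have hK1 : {(i, j)} ⊆ s.cur := Finset.singleton_subset_iff.2 hcur
      have hcur' : ∀ e, e ∈ (s.remove {(i, j)}).cur ↔ e ∈ s.cur ∧ e ≠ (i, j) := by
        intro e
        exact Finset.mem_sdiff.trans (by rw [Finset.mem_singleton])
      have hunion : {(i, j)} ∪ K.erase (i, j) = K := by
        rw [← Finset.insert_eq, Finset.insert_erase hiK]
      have hfst : ∀ e ∈ s.cur, e ≠ (i, j) → e.1 ≠ i := by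
        rintro ⟨k, l⟩ hkl hne rfl
        exact hne (by rw [hs.left hkl hcur])
      refine (ih (s.remove {(i, j)}) (K.erase (i, j)) (fun k => P k && decide (k ≠ i)) y ?_
        (hs.remove hK1) ?_ ?_ ?_ ?_).mono (by omega)
      · rw [Finset.card_erase_of_mem hiK]
        omega
      · intro e he
        rw [Finset.mem_erase] at he
        exact (hcur' e).2 ⟨hK he.2, he.1⟩
      · rw [AlgState.remove_remove, hunion]
        exact hdone
      · intro e he
        rw [hcur'] at he
        simp [hfst e he.1 he.2, he.2, hP e he.1]
      · rw [hx.id] at hy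
        have hyi : ∀ k, y k = { x k with
            edge := fun l => (x k).edge l && decide (k ≠ i) && decide (l ≠ j)
            mate := if k = i then none else (x k).mate
            sel := if k = i then some j else (x k).sel
            pos := (x k).pos && decide (k ≠ i) } := by
          intro k
          rw [hy k]
          by_cases hk : k = i
          · simp [Agent.update, hx.phase, hx.id, hk]
          · simp [Agent.update, hx.phase, hx.id, hk]
        constructor
        · intro k; rw [hyi]; exact hx.id k
        · intro k l; rw [hyi]; exact hx.wt k l
        · intro k l
          rw [hyi, AlgState.mem_remove_es hs, ← hx.edge]
          simp only [Bool.and_eq_true, decide_eq_true_eq, Finset.mem_singleton, forall_eq,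
            and_assoc, ne_comm (a := k) (b := i), ne_comm (a := l) (b := j)]
        · intro k l; rw [hyi]; exact hx.edgeOld k l
        · intro k l
          rw [hyi, hcur', ← hx.mate]
          by_cases hk : k = i
          · subst hk
            simp only [if_true, reduceCtorEq, hij, Option.some.injEq, false_iff, not_and, not_not]
            rintro rfl
            rfl
          · simp [hk]
        · intro k l
          have : (k, l) ∈ (s.remove {(i, j)}).sol ↔ (k, l) ∈ s.sol ∨ (k, l) = (i, j) := by
            exact Finset.mem_union.trans (by rw [Finset.mem_singleton])
          rw [hyi, this]
          by_cases hk : k = i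
          · subst hk
            -- An agent still in the graph has no selected partner yet, so writing `sel` overwrites
            -- nothing.
            have hno : (k, l) ∉ s.sol := fun h => hs.sol h (hs.mem_vs (hs.sub hcur)).1
            simp [hno, eq_comm]
          · simp [hk, hx.sel]
        · intro k; rw [hyi]; exact hx.flag k
        · intro k; rw [hyi]; exact hx.tested k
        · intro k; rw [hyi]; simp only [hx.pos]
        · intro k; rw [hyi]; exact hx.phase k

theorem mem_shrunk {s : AlgState n} {b : Edge n} (hb : b ∈ heaviest w s.cur) {e : Edge n} :
    e ∈ s.shrunk w ↔ e ∈ s.cur ∨ e ∈ s.es ∧ w e < w b := by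
  rw [AlgState.shrunk, Finset.mem_union, mem_strictSublevel hb]

theorem AlgState.IsValid.shrunk_subset {s : AlgState n} (hs : s.IsValid) (w : Edge n → W) :
    s.shrunk w ⊆ s.es :=
  Finset.union_subset hs.sub (Finset.filter_subset _ _)

theorem AlgState.IsValid.setShrunk {s : AlgState n} (hs : s.IsValid) (w : Edge n → W) (f : Bool) :
    ({ s with es := s.shrunk w, flag := f } : AlgState n).IsValid where
  sub := Finset.subset_union_left
  left := hs.left
  right := hs.right
  mem_vs he := hs.mem_vs (hs.shrunk_subset w he)
  agent := hs.agent
  task := hs.task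
  sol := hs.sol

/-- A bound on the number of rounds from the beginning of an iteration to the end of the
program. -/
def AlgState.potential (w : Edge n → W) (s : AlgState n) : ℕ :=
  10 * n * (s.shrunk w).card + 10 * n ^ 2 * s.cur.card

/-- The agents are at the beginning of an iteration with the variables `s`. -/
def AtPick (w : Edge n → W) (s : AlgState n) (x : Config W n) : Prop :=
  ∃ Eo T P, View w s.es Eo s.cur s.sol s.flag T P .pick x

/-- The part of an iteration that follows the discovery of a critical edge. -/
theorem within_critical {s : AlgState n} (hs : s.IsValid) {b : Edge n}
    (hb : b ∈ heaviest w s.cur)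
    (hcrit : AugPathReturns s.es (s.cur \ {b}) (s.shrunk w \ {b}) (s.cur \ {b}))
    (hdone : ∀ (s' : AlgState n) (y : Config W n), Iter w s s' → s'.IsValid →
      s'.es ⊆ s.shrunk w → s'.cur ⊂ s.cur → AtPick w s' y → Within Q N y)
    {x : Config W n}
    (hx : View w (s.shrunk w) s.es s.cur s.sol s.flag (fun _ => false) (fun _ => false)
      (.nextEdge b (w b)) x) : Within Q (N + n * (n + 2) + n + 3) x := by
  have hb' := mem_heaviest.1 hb
  -- The for-loop takes `n * (n + 2) + 1` rounds, the check for a heaviest marked edge one, and the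
  -- pruning `n + 1`.
  have hrew : N + n * (n + 2) + n + 3 = (N + n + 2) + n * (n + 2) + 1 := by ring
  rw [hrew]
  refine within_forLoop hs.isSpanning hb (fun T P y hmark hy => ?_) (fun _ _ _ => rfl)
    (fun _ _ h => by simp at h) hx
  have hR : ∀ e : Edge n, ∃ R, e ∈ s.cur →
      AugPathReturns s.es (s.cur \ {e}) (sublevel w s.es s.cur \ {e}) R ∧
        (P e.1 = true ↔ R = s.cur \ {e}) := by
    intro e
    by_cases he : e ∈ s.cur
    · obtain ⟨R, hR⟩ := hmark e he
      exact ⟨R, fun _ => hR⟩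
    · exact ⟨∅, fun h => absurd h he⟩
  choose R hR using hR
  set pos : Finset (Edge n) := s.cur.filter fun e => R e = s.cur \ {e} with hpos
  have hmem : ∀ e ∈ s.cur, P e.1 = true ↔ e ∈ pos := by
    intro e he
    rw [(hR e he).2, hpos, Finset.mem_filter]
    simp [he]
  have hiter := Iter.critical s b R pos hb hcrit (fun e he => (hR e he).1) hpos
  have hposcur : pos ⊆ s.cur := Finset.filter_subset _ _
  have hfinish : ∀ (f : Bool) (K : Finset (Edge n)), K ⊆ s.cur → K.Nonempty →
      Iter w s (({ s with es := s.shrunk w, flag := f } : AlgState n).remove K) →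
      ∀ (T P : Fin n → Bool) (z : Config W n), (∀ e ∈ s.cur, P e.1 = true ↔ e ∈ K) →
      View w (s.shrunk w) s.es s.cur s.sol f T P .prune z → Within Q (N + n + 1) z := by
    intro f K hK hne hit T P z hP hz
    have hv := hs.setShrunk w f
    refine within_prune hv hK (fun T P v hv' => ?_) hP hz
    refine hdone _ v hit (hv.remove hK) (Finset.filter_subset _ _) ?_ ⟨_, _, _, hv'⟩
    exact Finset.sdiff_ssubset hK hne
  refine .step _ _ fun z ⟨r, hr, hz⟩ => ?_
  rcases hr with ⟨rfl, hr⟩ | ⟨i, j, hij, rfl, -⟩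
  · have hempty : pos ∩ heaviest w s.cur = ∅ := by
      refine Finset.eq_empty_of_forall_notMem fun e he => ?_
      rw [Finset.mem_inter, mem_heaviest] at he
      -- All heaviest edges have the weight of `b`, so each agent can recognise them by comparison
      -- with the broadcast weight.
      have hwe : w e = w b := le_antisymm (hb'.2 e he.2.1) (he.2.2 b hb'.1)
      have := hr e.1
      simp [Agent.nominee, hy.phase, hy.pos, (hy.mate e.1 e.2).2 he.2.1, hy.wt,
        (hmem e he.2.1).2 he.1, hwe] at this
    rw [if_pos hempty] at hiter
    refine hfinish false (pos ∪ {b}) ?_ ⟨b, by simp⟩ hiter T (fun k => P k || decide (k = b.1)) z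
      (fun e he => ?_) ?_
    · exact Finset.union_subset hposcur (Finset.singleton_subset_iff.2 hb'.1)
    · have : e.1 = b.1 ↔ e = b := by
        refine ⟨fun h => Prod.ext h ?_, fun h => h ▸ rfl⟩
        exact hs.left (i := e.1) he (h ▸ hb'.1)
      simp [hmem e he, this, or_comm]
    · constructor <;> intros <;> simp only [hz, Agent.update, hy.phase]
      exacts [hy.id _, hy.wt _ _, hy.edge _ _, hy.edgeOld _ _, hy.mate _ _, hy.sel _ _,
        hy.tested _, by rw [hy.pos, hy.id]]
  · have hij' : (i, j) ∈ pos ∩ heaviest w s.cur := by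
      cases hm : (y i).mate with
      | none => simp [Agent.nominee, hy.phase, hm] at hij
      | some l =>
        simp only [Agent.nominee, hy.phase, hm, hy.pos, hy.wt] at hij
        split_ifs at hij with hc
        obtain rfl := Option.some.inj hij
        rw [Bool.and_eq_true, decide_eq_true_eq] at hc
        have hcur := (hy.mate i l).1 hm
        rw [Finset.mem_inter, mem_heaviest]
        exact ⟨(hmem _ hcur).1 hc.1, hcur, fun e' he' => hc.2 ▸ hb'.2 e' he'⟩
    have hne : pos ∩ heaviest w s.cur ≠ ∅ := Finset.ne_empty_of_mem hij'
    rw [if_neg hne] at hiter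
    refine hfinish s.flag pos hposcur ⟨_, (Finset.mem_inter.1 hij').1⟩ hiter T P z hmem ?_
    constructor <;> intros <;> simp only [hz, Agent.update, hy.phase]
    exacts [hy.id _, hy.wt _ _, hy.edge _ _, hy.edgeOld _ _, hy.mate _ _, hy.sel _ _,
      hy.flag _, hy.tested _, hy.pos _]

end Iteration

section Iteration

variable {w : Edge n → W} {Q : Config W n → Prop} {N : ℕ}

/-- One iteration of the while-loop is carried out in a number of rounds that is covered by the
decrease of the potential. -/
theorem within_iteration {s : AlgState n} (hs : s.IsValid) (hn : 1 ≤ n) (hcur : s.cur ≠ ∅)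
    (hdone : ∀ (s' : AlgState n) (y : Config W n), Iter w s s' → s'.IsValid →
      s'.potential w < s.potential w → AtPick w s' y → Within Q (N + s'.potential w) y)
    {x : Config W n} (hx : AtPick w s x) : Within Q (N + s.potential w) x := by
  obtain ⟨Eo, T, P, hx⟩ := hx
  have hpos : 1 ≤ s.cur.card := Finset.card_pos.2 (Finset.nonempty_iff_ne_empty.2 hcur)
  have hshrunk : s.cur.card ≤ (s.shrunk w).card := Finset.card_le_card Finset.subset_union_left
  have hsq : n ≤ n ^ 2 := by nlinarith
  obtain ⟨A, hA⟩ : ∃ A, (s.shrunk w).card = A + 1 := ⟨(s.shrunk w).card - 1, by omega⟩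
  obtain ⟨B, hB⟩ : ∃ B, s.cur.card = B + 1 := ⟨s.cur.card - 1, by omega⟩
  have hpot : s.potential w = 10 * n * (A + 1) + 10 * n ^ 2 * (B + 1) := by
    rw [AlgState.potential, hA, hB]
  -- The first search is common to both outcomes, so its continuation needs one bound: the maximum
  -- of the critical cost, where the matching loses an edge, and the noncritical cost, where the
  -- searched edge set does. The outer `n + 1 + 1` pays for that search and for picking `b`.
  refine Within.mono (N := max (N + (10 * n * (A + 1) + 10 * n ^ 2 * B) + n * (n + 2) + n + 3)
    (N + (10 * n * A + 10 * n ^ 2 * (B + 1)) + n + 1) + n + 1 + 1) (.step _ _ ?_) ?_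
  · rintro y ⟨r, hr, hy⟩
    rcases hr with ⟨rfl, hr⟩ | ⟨i, j, hij, rfl, hmax⟩
    · refine absurd (Finset.eq_empty_of_forall_notMem fun e he => ?_) hcur
      have := hr e.1
      simp [Agent.nominee, hx.phase, (hx.mate e.1 e.2).2 he] at this
    · have hnom : ∀ k, (x k).nominee = (x k).mate := by
        intro k
        simp [Agent.nominee, hx.phase]
      have he : (i, j) ∈ s.cur := (hx.mate i j).1 (hnom i ▸ hij)
      have hb : (i, j) ∈ heaviest w s.cur := by
        refine mem_heaviest.2 ⟨he, fun e he' => ?_⟩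
        have := hmax e.1 e.2 (by rw [hnom, (hx.mate e.1 e.2).2 he'])
        rwa [hx.wt, hx.wt] at this
      clear hij
      rw [hx.id, hx.wt] at hy
      have hM := hs.isSpanning
      have hSE : s.shrunk w \ {(i, j)} ⊆ s.es := Finset.sdiff_subset.trans (hs.shrunk_subset w)
      have hMS : s.cur \ {(i, j)} ⊆ s.shrunk w \ {(i, j)} :=
        Finset.sdiff_subset_sdiff Finset.subset_union_left le_rfl
      set p : Phase W n := .searchCrit (i, j) (w (i, j)) with hpdef
      have hp : IsSearchPhase w (s.shrunk w) s.es p (s.shrunk w \ {(i, j)}) (i, j) :=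
        .inl ⟨_, rfl, fun e => by rw [Finset.mem_sdiff, Finset.mem_singleton]⟩
      set x' : Config W n := fun k => { x k with
          edgeOld := (x k).edge
          edge := fun j' => decide ((x k).mate = some j') ||
            ((x k).edge j' && decide ((x k).wt j' < w (i, j)))
          tested := false
          pos := false
          phase := p, parent := none, expanded := false } with hx'def
      have hx' : View w (s.shrunk w) s.es s.cur s.sol s.flag (fun _ => false) (fun _ => false)
          p x' := by
        constructor <;> intros <;> dsimp only [x']
        · exact hx.id _
        · exact hx.wt _ _
        · rw [mem_shrunk hb, Bool.or_eq_true, Bool.and_eq_true, decide_eq_true_eq,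
            decide_eq_true_eq, hx.mate, hx.edge, hx.wt]
        · exact hx.edge _ _
        · exact hx.mate _ _
        · exact hx.sel _ _
        · exact hx.flag _
      have hy' : y = fun k => (x' k).reach j := by
        funext k
        rw [hy k]
        simp only [Agent.update, hx.phase, Agent.startSearch, hpdef, hx'def]
      rw [hy']
      refine IsSearching.within hp hM hSE he (fun z hz hall v hv => ?_)
        (fun z hz hroot v r hv => ?_) (hx'.isSearching_reach hp (fun _ => rfl) fun _ => rfl)
      · obtain ⟨rank, hinv⟩ := hz.inv
        refine Within.mono ?_ (le_max_left _ _)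
        refine within_critical hs hb (hinv.augPathReturns_of_fail hM hSE hall)
          (fun s' u hit hs' hes hcur' hu => ?_) (x := v) ?_
        · have h1 : (s'.shrunk w).card ≤ A + 1 :=
            hA ▸ Finset.card_le_card ((hs'.shrunk_subset w).trans hes)
          have h2 : s'.cur.card ≤ B := by
            have := Finset.card_lt_card hcur'
            omega
          have h3 : s'.potential w ≤ 10 * n * (A + 1) + 10 * n ^ 2 * B :=
            Nat.add_le_add (Nat.mul_le_mul_left _ h1) (Nat.mul_le_mul_left _ h2)
          exact (hdone s' u hit hs' (by rw [hpot]; nlinarith) hu).mono (by omega)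
        · have hz := hz.view
          constructor <;> intros <;> simp only [hv, Agent.update, hz.phase, hpdef]
          exacts [hz.id _, hz.wt _ _, hz.edge _ _, hz.edgeOld _ _, hz.mate _ _, hz.sel _ _,
            hz.flag _, hz.tested _, hz.pos _]
      · obtain ⟨rank, hinv⟩ := hz.inv
        refine Within.mono ?_ (le_max_right _ _)
        have hz := hz.view
        have hvk : ∀ k, v k = { z k with
            phase := .augment (i, j), active := decide ((z k).id = i) } := by
          intro k
          rw [hv k]
          simp only [Agent.update, hz.phase, hpdef, if_true]
        have hpairs : pairs (fun k => (z k).mate) = s.cur := by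
          ext ⟨k, l⟩
          rw [mem_pairs, hz.mate]
        refine AugInv.within (w := w) (E := s.shrunk w) (L := s.sol) (f := s.flag)
          (T := fun _ => false) (P := fun _ => false) hinv hM hSE (fun m u hm hu => ?_)
          (AugInv.init hM he hMS hroot hz.mate) (x := v) ?_ (fun k => by rw [hvk])
          (fun k => by rw [hvk, hz.id])
        · obtain ⟨hret, hne⟩ := hinv.augPathReturns_of_isRematch hM hSE he hMS hroot hm
          have hit := Iter.noncritical s (i, j) (pairs m) hb hret hne
          have hmS : pairs m ⊆ s.shrunk w \ {(i, j)} := by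
            rintro ⟨k, l⟩ hkl
            exact hm.sub (mem_pairs.1 hkl)
          have hspan := hm.isSpanning hM hSE
          have hvalid : ({ s with es := s.shrunk w, cur := pairs m } : AlgState n).IsValid :=
            { sub := hmS.trans Finset.sdiff_subset
              left := hspan.left
              right := hspan.right
              mem_vs := fun h => hs.mem_vs (hs.shrunk_subset w h)
              agent := fun {k} hk => by
                obtain ⟨l, hl⟩ := Option.ne_none_iff_exists'.1 ((hm.agent k).2 (hs.agent hk))
                exact ⟨l, mem_pairs.2 hl⟩
              task := fun {l} hl => by
                obtain ⟨k, hk⟩ := hs.task hl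
                obtain ⟨k', hk'⟩ := hm.task hk
                exact ⟨k', mem_pairs.2 hk'⟩
              sol := hs.sol }
          -- The tested edge drops out: it is not in the new matching, and it is not strictly
          -- lighter than any edge of it, because that matching lies in the old shrunk set, where no
          -- weight exceeds that of the tested edge.
          have hlt : (({ s with es := s.shrunk w, cur := pairs m } : AlgState n).shrunk w).card ≤
              A := by
            refine Nat.le_of_lt_succ (lt_of_lt_of_eq (Finset.card_lt_card ?_) hA)
            refine (Finset.ssubset_iff_of_subset (hvalid.shrunk_subset w)).2
              ⟨(i, j), Finset.subset_union_left he, fun h => ?_⟩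
            rcases Finset.mem_union.1 h with h | h
            · exact (Finset.mem_sdiff.1 (hmS h)).2 (Finset.mem_singleton_self _)
            · obtain ⟨-, e', he', hlt⟩ := Finset.mem_filter.1 h
              have := (Finset.mem_sdiff.1 (hmS he')).1
              rcases (mem_shrunk hb).1 this with h' | h'
              · exact absurd hlt (not_lt.2 ((mem_heaviest.1 hb).2 e' h'))
              · exact absurd hlt (not_lt.2 h'.2.le)
          have hcard : (pairs m).card = B + 1 :=
            hB ▸ le_antisymm (hM.isMCM.2 _ hspan.isMatching) (hspan.isMCM.2 _ hM.isMatching)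
          have h3 : ({ s with es := s.shrunk w, cur := pairs m } : AlgState n).potential w ≤
              10 * n * A + 10 * n ^ 2 * (B + 1) :=
            Nat.add_le_add (Nat.mul_le_mul_left _ hlt) (Nat.mul_le_mul_left _ hcard.le)
          exact (hdone _ u hit hvalid (by rw [hpot]; nlinarith) ⟨_, _, _, hu⟩).mono (by omega)
        · rw [hpairs]
          constructor <;> intros <;> simp only [hvk]
          exacts [hz.id _, hz.wt _ _, hz.edge _ _, hz.edgeOld _ _, hz.mate _ _, hz.sel _ _,
            hz.flag _, hz.tested _, hz.pos _]
  · rw [hpot]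
    -- Both branches leave a reserve of `3 * n`, which covers the `n + 2` rounds spent before them
    -- since `1 ≤ n`.
    have : max (N + (10 * n * (A + 1) + 10 * n ^ 2 * B) + n * (n + 2) + n + 3)
        (N + (10 * n * A + 10 * n ^ 2 * (B + 1)) + n + 1) ≤
        N + (10 * n * (A + 1) + 10 * n ^ 2 * (B + 1)) - 3 * n := by
      refine max_le ?_ ?_ <;> refine Nat.le_sub_of_add_le ?_ <;> nlinarith
    have h2 : 3 * n ≤ 10 * n * (A + 1) := by nlinarith
    omega

/-! ### Termination and the cubic bound. -/

/-- The agents have halted, and what they hold is the output of an execution of the algorithm. -/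
def IsCorrectHalt (w : Edge n → W) (E M₀ : Finset (Edge n)) (x : Config W n) : Prop :=
  ∃ Mb U, ((∀ i, (x i).phase = .halted) ∧ (∀ i j, (i, j) ∈ Mb ↔ (x i).sel = some j) ∧
    ∀ i, (x i).flag = U) ∧ AlgOutput w E M₀ Mb U

/-- Strong induction on the potential. The extra `1` is the last round, in which nobody has a
partner left to nominate and all agents halt. -/
theorem within_isCorrectHalt {E M₀ : Finset (Edge n)} (hn : 1 ≤ n) (s : AlgState n)
    (hs : s.IsValid) (hreach : Relation.ReflTransGen (Iter w) (AlgState.init E M₀) s)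
    (x : Config W n) (hx : AtPick w s x) :
    Within (IsCorrectHalt w E M₀) (1 + s.potential w) x := by
  induction hk : s.potential w using Nat.strong_induction_on generalizing s x with
  | _ k ih =>
    by_cases hcur : s.cur = ∅
    · obtain ⟨Eo, T, P, hx⟩ := hx
      refine Within.mono (.step 0 _ ?_) (by omega)
      rintro y ⟨r, hr, hy⟩
      have hmate : ∀ k, (x k).mate = none := by
        intro k
        by_contra h
        obtain ⟨j, hj⟩ := Option.ne_none_iff_exists'.1 h
        have := (hx.mate k j).1 hj
        simp [hcur] at this
      rcases hr with ⟨rfl, hr⟩ | ⟨i, j, hij, -, -⟩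
      · refine .done _ _ ⟨s.sol, s.flag, ⟨fun k => ?_, fun k l => ?_, fun k => ?_⟩,
          s, hreach, hcur, rfl, rfl⟩ <;> simp only [hy, Agent.update, hx.phase]
        exacts [(hx.sel _ _).symm, hx.flag _]
      · simp [Agent.nominee, hx.phase, hmate] at hij
    · rw [← hk]
      refine within_iteration hs hn hcur (fun s' y hit hs' hlt hy => ?_) hx
      exact ih _ (hk ▸ hlt) s' hs' (hreach.tail hit) y hy rfl

theorem atPick_init {V : Type} {w : Edge n → V} {E M₀ : Finset (Edge n)} (hM : IsMatching E M₀) :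
    AtPick w (AlgState.init E M₀) (initConfig w E M₀) := by
  refine ⟨E, fun _ => false, fun _ => false, fun _ => rfl, fun _ _ => rfl,
    fun _ _ => decide_eq_true_iff, fun _ _ => decide_eq_true_iff, fun i j => ?_, fun i j => ?_,
    fun _ => rfl, fun _ => rfl, fun _ => rfl, fun _ => rfl⟩
  · change (List.finRange n).find? (fun j => decide ((i, j) ∈ M₀)) = some j ↔ (i, j) ∈ M₀
    constructor
    · intro h
      simpa using List.find?_some h
    · intro h
      cases hf : (List.finRange n).find? fun j => decide ((i, j) ∈ M₀) with
      | none =>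
        have := List.find?_eq_none.1 hf j (List.mem_finRange j)
        simp [h] at this
      | some l =>
        have hl : (i, l) ∈ M₀ := by simpa using List.find?_some hf
        rw [(isMatching_iff.1 hM).2.1 _ _ _ hl h]
  · change none = some j ↔ (i, j) ∈ (∅ : Finset (Edge n))
    simp

end Iteration

theorem runsWithin_cubic (w : Edge n → W) {E M₀ : Finset (Edge n)} (hM : IsMCM E M₀)
    (hcard : M₀.card = n) (GC : SimpleGraph (Fin n)) [DecidableRel GC.Adj] (hconn : GC.Connected)
    (tie : ℕ → Fin n → ℕ) : RunsWithin GC tie w E M₀ (21 * n ^ 3 * max GC.diam 1) := by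
  have hn : 1 ≤ n := by
    obtain ⟨i⟩ := hconn.nonempty
    exact (Nat.zero_le _).trans_lt i.isLt
  -- At most `n * n` edges and exactly `n` matched ones give a potential of at most `20 * n ^ 3`;
  -- the halting round is absorbed by one more `n ^ 3`.
  have hpot : 1 + (AlgState.init E M₀).potential w ≤ 21 * n ^ 3 := by
    have h1 : ((AlgState.init E M₀).shrunk w).card ≤ n * n := by
      refine (Finset.card_le_univ _).trans_eq ?_
      rw [Fintype.card_prod, Fintype.card_fin]
    have h2 : (AlgState.init E M₀).cur.card = n := hcard
    have h3 : 1 ≤ n ^ 3 := Nat.one_le_pow _ _ hn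
    rw [AlgState.potential, h2]
    nlinarith [Nat.mul_le_mul_left (10 * n) h1]
  obtain ⟨t, ht, Mb, U, hhalt, hout⟩ := exists_network_of_within GC tie w E M₀ hconn
    ((within_isCorrectHalt hn _ (AlgState.isValid_init hM.1 hcard) .refl _
      (atPick_init (w := w) hM.1)).mono hpot)
  exact ⟨t, ht, Mb, U, hhalt, hout⟩

end SeqBAP

theorem mainTheorem7 :
    ∃ C : ℕ, ∀ (n : ℕ) (E : Finset (SeqBAP.Edge n)) (w : SeqBAP.Edge n → ℝ)
      (M₀ : Finset (SeqBAP.Edge n)), SeqBAP.IsMCM E M₀ → M₀.card = n →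
      ∀ (GC : SimpleGraph (Fin n)) [DecidableRel GC.Adj], GC.Connected →
      ∀ tie : ℕ → Fin n → ℕ,
        SeqBAP.RunsWithin GC tie w E M₀ (C * n ^ 3 * max GC.diam 1) ∧
        (GC = ⊤ → SeqBAP.RunsWithin GC tie w E M₀ (C * n ^ 3)) := by
  refine ⟨21, fun n E w M₀ hM hcard GC _ hconn tie => ?_⟩
  have h := SeqBAP.runsWithin_cubic w hM hcard GC hconn tie
  refine ⟨h, fun htop => ?_⟩
  -- The complete graph has diameter `1`, or `0` if there is a single agent.
  have hdiam : max GC.diam 1 = 1 := by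
    refine max_eq_right ?_
    subst htop
    rcases subsingleton_or_nontrivial (Fin n) with hsub | hnt
    · rw [SimpleGraph.diam_eq_zero.2 (.inr hsub)]
      exact Nat.zero_le _
    · rw [SimpleGraph.diam_top]
  rwa [hdiam, mul_one] at h
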